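/- A relation $R\subseteq\{0,1\}^*\times\{0,1\}^*$ is \emph{polynomially bounded} if there is a polynomial $p$ with $|y|\le p(|x|)$ for all $(x,y)\in R$; call $x$ \emph{solvable} if $(x,y)\in R$ for some $y$. $\mathsf{FBPP}$ is the class of polynomially bounded relations $R$ for which there is a randomized algorithm $A$, running (for all outcomes of its coins) in time polynomial in the length of its input, such that $\Pr[(x,A(x,0^{\lceil 1/\varepsilon\rceil}))\in R]\ge 1-\varepsilon$ for all solvable $x$ and all $\varepsilon>0$. A promise problem is a pair $\Pi=(\Pi_{\mathrm{yes}},\Pi_{\mathrm{no}})$ of disjoint subsets of $\{0,1\}^*$. $\mathsf{PromiseBPEXP}$ is the class of promise problems for which there are a polynomial $p$ and a randomized algorithm that on every input $w$ halts within $2^{p(|w|)}$ steps, accepts every $w\in\Pi_{\mathrm{yes}}$ with probability at least $2/3$, and accepts every $w\in\Pi_{\mathrm{no}}$ with probability at most $1/3$. $\mathsf{PromiseP/poly}$ is the class of promise problems for which there are a deterministic polynomial-time algorithm $A$ and advice strings $(a_n)_{n\ge 0}$, with $|a_n|$ bounded by a polynomial in $n$, such that $A(w,a_{|w|})$ accepts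 for $w\in\Pi_{\mathrm{yes}}$ and does not accept for $w\in\Pi_{\mathrm{no}}$. $\mathsf{FP}^{\mathsf{PromiseBPEXP}}$ is the class of polynomially bounded relations $R$ for which there are a problem $\Pi\in\mathsf{PromiseBPEXP}$ and a deterministic polynomial-time oracle algorithm $M$ such that, for every oracle $O:\{0,1\}^*\to\{0,1\}$ that equals $1$ on $\Pi_{\mathrm{yes}}$ and $0$ on $\Pi_{\mathrm{no}}$ (with arbitrary values elsewhere), $(x,M^O(x))\in R$ for all solvable $x$. $\mathsf{FP/poly}$ is the class of polynomially bounded relations $R$ for which there are a deterministic polynomial-time algorithm $A$ and advice strings $(a_n)_{n\ge 0}$, with $|a_n|$ bounded by a polynomial in $n$, such that $(x,A(x,a_{|x|}))\in R$ for all solvable $x$. \textbf{Theorem.} $\mathsf{FBPP}\subseteq\mathsf{FP}^{\mathsf{PromiseBPEXP}}$. Hence, if $\mathsf{PromiseBPEXP}\subseteq\mathsf{PromiseP/poly}$, then $\mathsf{FBPP}\subseteq\mathsf{FP/poly}$. -/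

import Mathlib

namespace RelComplexity

/-- Binary strings; the bit `1` is `true` and the bit `0` is `false`. -/
abbrev Str : Type := List Bool

/-- Relational problems `R ⊆ {0,1}* × {0,1}*`. -/
abbrev Relation : Type := Set (Str × Str)

/-! ### The machine model

A multi-stack machine.  Finitely many stacks of bits (indexed by natural numbers) are accessed only
at their tops, by a finite control given as a structured program.  Two stacks make up a tape, so
this is the multi-tape Turing machine up to a constant factor in time.  There are a coin-tossing
instruction and an oracle-query instruction; deterministic programs are those without the first, and
ordinary (oracle-free) programs those without the second. -/

/-- Programs. -/
inductive Prog : Type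
  /-- do nothing -/
  | skip : Prog
  /-- push the bit `b` on stack `i` -/
  | push (i : ℕ) (b : Bool) : Prog
  /-- remove the top of stack `i` (nothing happens if it is empty) -/
  | pop (i : ℕ) : Prog
  /-- push a fresh random bit on stack `i` -/
  | toss (i : ℕ) : Prog
  /-- push on stack `i` the answer of the oracle to the string on stack `q` -/
  | query (q i : ℕ) : Prog
  /-- first `c`, then `d` -/
  | seq (c d : Prog) : Prog
  /-- run `c₁`, `c₀` or `cₑ` according as the top of stack `i` is `1`, is `0`, or is missing -/
  | branch (i : ℕ) (c₁ c₀ cₑ : Prog) : Prog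
  /-- as long as stack `i` is nonempty, run `c` -/
  | loop (i : ℕ) (c : Prog) : Prog

/-- The program never tosses a coin, i.e. it is deterministic. -/
def Prog.TossFree : Prog → Prop
  | .skip => True
  | .push _ _ => True
  | .pop _ => True
  | .toss _ => False
  | .query _ _ => True
  | .seq c d => c.TossFree ∧ d.TossFree
  | .branch _ c₁ c₀ cₑ => c₁.TossFree ∧ c₀.TossFree ∧ cₑ.TossFree
  | .loop _ c => c.TossFree

/-- The program never queries the oracle. -/
def Prog.QueryFree : Prog → Prop
  | .skip => True
  | .push _ _ => True
  | .pop _ => True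
  | .toss _ => True
  | .query _ _ => False
  | .seq c d => c.QueryFree ∧ d.QueryFree
  | .branch _ c₁ c₀ cₑ => c₁.QueryFree ∧ c₀.QueryFree ∧ cₑ.QueryFree
  | .loop _ c => c.QueryFree

/-- The contents of all stacks; the head of a list is the top of the stack. -/
abbrev Store : Type := ℕ → Str

/-- A configuration: the list of program parts still to be executed, in order, and the store.
The machine has halted when nothing is left to be executed. -/
abbrev Cfg : Type := List Prog × Store

/-- One step of the machine with oracle `O`.  The bit `b` is the outcome of the coin for this step;
it is used only if the step is a coin toss.  A halted configuration does not change. -/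
def step (O : Str → Bool) (b : Bool) : Cfg → Cfg
  | ([], s) => ([], s)
  | (.skip :: k, s) => (k, s)
  | (.push i a :: k, s) => (k, Function.update s i (a :: s i))
  | (.pop i :: k, s) => (k, Function.update s i (s i).tail)
  | (.toss i :: k, s) => (k, Function.update s i (b :: s i))
  | (.query q i :: k, s) => (k, Function.update s i (O (s q) :: s i))
  | (.seq c d :: k, s) => (c :: d :: k, s)
  | (.branch i c₁ c₀ cₑ :: k, s) =>
      match s i with
      | true :: _ => (c₁ :: k, s)
      | false :: _ => (c₀ :: k, s)
      | [] => (cₑ :: k, s)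
  | (.loop i c :: k, s) =>
      match s i with
      | [] => (k, s)
      | _ :: _ => (c :: .loop i c :: k, s)

/-- The initial store: the first input `u` on stack `0`, the second input `v` on stack `1`. -/
def input (u v : Str) : Store
  | 0 => u
  | 1 => v
  | _ => []

/-- The oracle of oracle-free computations; it is never asked. -/
def noOracle : Str → Bool := fun _ => false

/-- The configuration of the deterministic program `c` after `T` steps, from the store `s`. -/
def runDet (O : Str → Bool) (c : Prog) (s : Store) (T : ℕ) : Cfg :=
  (step O false)^[T] ([c], s)

/-- The configuration of the randomized program `c` after `T` steps, from the store `s`, where the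
coin for the `j`-th step shows `r j`. -/
def runRand (c : Prog) (s : Store) {T : ℕ} (r : Fin T → Bool) : Cfg :=
  (List.ofFn r).foldl (fun κ b => step noOracle b κ) ([c], s)

/-- The output is the contents of stack `0`. -/
def Cfg.output (κ : Cfg) : Str := κ.2 0

/-- The deterministic program `c` halts within `T` steps. -/
def HaltsDet (O : Str → Bool) (c : Prog) (s : Store) (T : ℕ) : Prop :=
  (runDet O c s T).1 = []

/-- The randomized program `c` halts within `T` steps, whatever the coins show. -/
def HaltsRand (c : Prog) (s : Store) (T : ℕ) : Prop :=
  ∀ r : Fin T → Bool, (runRand c s r).1 = []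

/-- The output after `T` steps of the deterministic program `c`. -/
def outDet (O : Str → Bool) (c : Prog) (s : Store) (T : ℕ) : Str :=
  Cfg.output (runDet O c s T)

/-- The probability, over `T` independent fair coins, that the output of the randomized program `c`
after `T` steps lies in `E`. -/
noncomputable def prob (c : Prog) (s : Store) (T : ℕ) (E : Set Str) : ℝ :=
  (Nat.card {r : Fin T → Bool // Cfg.output (runRand c s r) ∈ E} : ℝ) / 2 ^ T

/-! ### Relational classes -/

/-- There is a polynomial `p` with `|y| ≤ p(|x|)` for all `(x, y) ∈ R`. -/
def PolyBounded (R : Relation) : Prop :=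
  ∃ p : Polynomial ℕ, ∀ x y : Str, (x, y) ∈ R → y.length ≤ p.eval x.length

/-- `x` has a solution. -/
def Solvable (R : Relation) (x : Str) : Prop := ∃ y : Str, (x, y) ∈ R

/-- `FBPP`: a randomized algorithm `A` running in time polynomial in the length of its input
`(x, 0^m)` satisfies `Pr[(x, A(x, 0^(1/ε))) ∈ R] ≥ 1 - ε` for all solvable `x` and all `ε > 0`
(with `1/ε` rounded up to an integer). -/
def FBPP : Set Relation :=
  {R | PolyBounded R ∧ ∃ (A : Prog) (p : Polynomial ℕ), A.QueryFree ∧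
    (∀ (x : Str) (m : ℕ),
      HaltsRand A (input x (List.replicate m false)) (p.eval (x.length + m))) ∧
    ∀ x : Str, Solvable R x → ∀ ε : ℝ, 0 < ε →
      1 - ε ≤ prob A (input x (List.replicate ⌈1 / ε⌉₊ false)) (p.eval (x.length + ⌈1 / ε⌉₊))
        {y | (x, y) ∈ R}}

/-- `FP/poly`: a deterministic algorithm `A`, running in time polynomial in the length of its input
`(x, a)`, finds a solution of every solvable `x` when given an advice string `a = a_{|x|}` that
depends only on the length of `x` and has length polynomial in it. -/
def FPPoly : Set Relation :=
  {R | PolyBounded R ∧ ∃ (A : Prog) (p q : Polynomial ℕ) (a : ℕ → Str), A.TossFree ∧ A.QueryFree ∧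
    (∀ u v : Str, HaltsDet noOracle A (input u v) (p.eval (u.length + v.length))) ∧
    (∀ n : ℕ, (a n).length ≤ q.eval n) ∧
    ∀ x : Str, Solvable R x →
      (x, outDet noOracle A (input x (a x.length)) (p.eval (x.length + (a x.length).length))) ∈ R}

/-! ### Promise problems -/

/-- A promise problem: disjoint sets of YES-instances and NO-instances. -/
structure PromiseProblem : Type where
  yes : Set Str
  no : Set Str
  disj : Disjoint yes no

/-- The oracle `O` answers correctly on the promise (its answers off the promise are arbitrary). -/
def PromiseProblem.Solves (Q : PromiseProblem) (O : Str → Bool) : Prop :=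
  (∀ w ∈ Q.yes, O w = true) ∧ (∀ w ∈ Q.no, O w = false)

/-- `PromiseBPEXP`: a randomized algorithm that always halts in time `2^{p(|w|)}`, `p` a polynomial,
accepts (outputs the one-bit string `1`) with probability at least `2/3` on YES-instances and at
most `1/3` on NO-instances. -/
def PromiseBPEXP : Set PromiseProblem :=
  {Q | ∃ (A : Prog) (p : Polynomial ℕ), A.QueryFree ∧
    (∀ w : Str, HaltsRand A (input w []) (2 ^ p.eval w.length)) ∧
    (∀ w ∈ Q.yes, 2 / 3 ≤ prob A (input w []) (2 ^ p.eval w.length) {[true]}) ∧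
    (∀ w ∈ Q.no, prob A (input w []) (2 ^ p.eval w.length) {[true]} ≤ 1 / 3)}

/-- `PromiseP/poly`: a deterministic algorithm `A`, running in time polynomial in the length of its
input `(w, a)`, accepts the YES-instances and does not accept the NO-instances when given an advice
string `a = a_{|w|}` of length polynomial in `|w|`. -/
def PromisePPoly : Set PromiseProblem :=
  {Q | ∃ (A : Prog) (p q : Polynomial ℕ) (a : ℕ → Str), A.TossFree ∧ A.QueryFree ∧
    (∀ u v : Str, HaltsDet noOracle A (input u v) (p.eval (u.length + v.length))) ∧
    (∀ n : ℕ, (a n).length ≤ q.eval n) ∧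
    (∀ w ∈ Q.yes, outDet noOracle A (input w (a w.length))
      (p.eval (w.length + (a w.length).length)) = [true]) ∧
    (∀ w ∈ Q.no, outDet noOracle A (input w (a w.length))
      (p.eval (w.length + (a w.length).length)) ≠ [true])}

/-- `FP^C` for a class `C` of promise problems: for some problem in `C`, a deterministic
polynomial-time oracle algorithm finds a solution of every solvable `x`, with every oracle that
answers correctly on the promise. -/
def FPOracle (C : Set PromiseProblem) : Set Relation :=
  {R | PolyBounded R ∧ ∃ Q ∈ C, ∃ (M : Prog) (p : Polynomial ℕ), M.TossFree ∧
    (∀ (O : Str → Bool) (x : Str), HaltsDet O M (input x []) (p.eval x.length)) ∧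
    ∀ O : Str → Bool, Q.Solves O → ∀ x : Str, Solvable R x →
      (x, outDet O M (input x []) (p.eval x.length)) ∈ R}

end RelComplexity

/-!
Let `A` be the algorithm of a relation `R` in `FBPP`, run on `(x, 0^m)`, where `m` is exponential in
`|x|`.  An output `y` is read as an infinite stream of bits, `stream y`: the bits of `y` from last
to first, then a `1`, then zeros; if `|y| < c`, then the first `c` bits of the stream determine `y`
(`decode_of_hit`).  For a word `z` let `q z` be the probability that the stream of the output
continues `z` (`hitProb`).

*The promise problem.*  The sampler (`sampler`) gets `x` and `z`, runs `A` on `(x, 0^m)`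
independently `m` times and accepts if the last of the streams that continue `z` does so with a `1`.
It accepts with probability `q (z1) * ∑ i < m, (1 - q z)^i` (`val_sampler`), which is nearly
`q (z1) / q z` as soon as `m * q z ≥ 8`.  The problem is to tell whether this is at least `2/3` or
at most `1/3`; it is in `PromiseBPEXP` (`acceptance_mem_promiseBPEXP`) because the sampler always halts
in exponential time.

*The search.*  The searcher (`searchProg`) starts with the empty word and asks for the next bit `b`
again and again.  Inside the promise the more likely bit is obtained, up to constants, and outside
the promise both bits are fine, so that `q (zb) ≥ q z / 4` whatever the oracle answers
(`hitProb_answer`).  After `c` rounds a word `z` of length `c` with `q z ≥ 4^(-c)` has been found.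
This exceeds the error probability `1 / m` of `A`, so some `y` with `(x, y) ∈ R` has a stream that
continues `z`; as `|y| < c`, it is the word that `z` encodes (`decode_search_mem`).  That the
accuracy can be exponentially good is what makes it unnecessary to recognize solutions.

*Advice.*  Queries are padded so that all queries for inputs of length `n` have the same length.
Hence a single advice string of a `P/poly` program for the promise problem serves all of them, and
the searcher with that program in place of the oracle is in `FP/poly`.

Programs are analysed by a predicate `Exec` for parts that toss no coins, with rules in the style of
Hoare logic, and by the expectation `ev` over the coins, with a rule `Val.append` for sequential
composition, for the part that runs `A`.
-/

namespace RelComplexity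

/-! ### Running programs -/

/-- The configuration reached from `κ` when the successive coins are the entries of `l`. -/
def run (O : Str → Bool) (l : List Bool) (κ : Cfg) : Cfg :=
  l.foldl (fun κ b => step O b κ) κ

@[simp] lemma run_nil (O : Str → Bool) (κ : Cfg) : run O [] κ = κ := rfl

@[simp] lemma run_cons (O : Str → Bool) (b : Bool) (l : List Bool) (κ : Cfg) :
    run O (b :: l) κ = run O l (step O b κ) := rfl

lemma run_append (O : Str → Bool) (l l' : List Bool) (κ : Cfg) :
    run O (l ++ l') κ = run O l' (run O l κ) := by
  simp [run, List.foldl_append]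

@[simp] lemma run_halted (O : Str → Bool) (l : List Bool) (s : Store) :
    run O l ([], s) = ([], s) := by
  induction l with
  | nil => rfl
  | cons b l ih => simpa [step] using ih

/-- A step of a nonempty control list does not look at what comes after it. -/
lemma step_append (O : Str → Bool) (b : Bool) (c : Prog) (l k : List Prog) (s : Store) :
    step O b (c :: l ++ k, s) = ((step O b (c :: l, s)).1 ++ k, (step O b (c :: l, s)).2) := by
  cases c <;> simp only [step, List.cons_append] <;> split <;> rfl

/-- Started from `s`, the program `c` ends in `s'` after at most `T` steps, whatever the coins
show.  The number of steps must not depend on the coins. -/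
def Exec (O : Str → Bool) (c : Prog) (s s' : Store) (T : ℕ) : Prop :=
  ∃ t ≤ T, ∀ (k : List Prog) (l : List Bool), l.length = t → run O l (c :: k, s) = (k, s')

namespace Exec

variable {O : Str → Bool} {c d : Prog} {s s' s'' : Store} {T T' : ℕ}

lemma mono (h : Exec O c s s' T) (hT : T ≤ T') : Exec O c s s' T' := by
  obtain ⟨t, ht, h⟩ := h
  exact ⟨t, ht.trans hT, h⟩

lemma cast (h : Exec O c s s' T) (hs : s' = s'') (hT : T ≤ T') : Exec O c s s'' T' :=
  hs ▸ h.mono hT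

/-- A program whose first step is coin-free and leads to running `d` from `s'`. -/
lemma of_step (h : ∀ b k, step O b (c :: k, s) = (d :: k, s')) (hd : Exec O d s' s'' T) :
    Exec O c s s'' (T + 1) := by
  obtain ⟨t, ht, hd⟩ := hd
  refine ⟨t + 1, by omega, fun k l hl => ?_⟩
  cases l with
  | nil => simp at hl
  | cons b l => rw [run_cons, h]; exact hd k l (by simpa using hl)

lemma of_last_step (h : ∀ b k, step O b (c :: k, s) = (k, s')) : Exec O c s s' 1 := by
  refine ⟨1, le_rfl, fun k l hl => ?_⟩
  obtain ⟨b, rfl⟩ := List.length_eq_one_iff.1 hl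
  simp [h]

lemma skip : Exec O .skip s s 1 := of_last_step fun _ _ => rfl

lemma push (i : ℕ) (a : Bool) : Exec O (.push i a) s (Function.update s i (a :: s i)) 1 :=
  of_last_step fun _ _ => rfl

lemma pop (i : ℕ) : Exec O (.pop i) s (Function.update s i (s i).tail) 1 :=
  of_last_step fun _ _ => rfl

lemma query (q i : ℕ) : Exec O (.query q i) s (Function.update s i (O (s q) :: s i)) 1 :=
  of_last_step fun _ _ => rfl

lemma seq (hc : Exec O c s s' T) (hd : Exec O d s' s'' T') :
    Exec O (.seq c d) s s'' (T + T' + 1) := by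
  obtain ⟨t, ht, hc⟩ := hc
  obtain ⟨t', ht', hd⟩ := hd
  refine ⟨t + t' + 1, by omega, fun k l hl => ?_⟩
  cases l with
  | nil => simp at hl
  | cons b l =>
    have hl : l.length = t + t' := by simpa using hl
    rw [run_cons, ← List.take_append_drop t l, run_append]
    have h1 := hc (d :: k) (l.take t) (by simp [hl])
    have h2 := hd k (l.drop t) (by simp [hl])
    change run O _ (run O _ (c :: d :: k, s)) = _
    rw [h1, h2]

lemma branch_true {i : ℕ} {c₁ c₀ e : Prog} {u : Str} (hi : s i = true :: u)
    (h : Exec O c₁ s s' T) : Exec O (.branch i c₁ c₀ e) s s' (T + 1) :=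
  of_step (fun b k => by simp [step, hi]) h

lemma branch_false {i : ℕ} {c₁ c₀ e : Prog} {u : Str} (hi : s i = false :: u)
    (h : Exec O c₀ s s' T) : Exec O (.branch i c₁ c₀ e) s s' (T + 1) :=
  of_step (fun b k => by simp [step, hi]) h

lemma branch_nil {i : ℕ} {c₁ c₀ e : Prog} (hi : s i = [])
    (h : Exec O e s s' T) : Exec O (.branch i c₁ c₀ e) s s' (T + 1) :=
  of_step (fun b k => by simp [step, hi]) h

lemma loop_nil {i : ℕ} (hi : s i = []) : Exec O (.loop i c) s s 1 :=
  of_last_step fun b k => by simp [step, hi]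

lemma loop_cons {i : ℕ} (hi : s i ≠ []) (hc : Exec O c s s' T)
    (hl : Exec O (.loop i c) s' s'' T') : Exec O (.loop i c) s s'' (T + T' + 1) := by
  obtain ⟨t, ht, hc⟩ := hc
  obtain ⟨t', ht', hd⟩ := hl
  refine ⟨t + t' + 1, by omega, fun k l hl => ?_⟩
  cases l with
  | nil => simp at hl
  | cons b l =>
    have hl : l.length = t + t' := by simpa using hl
    rw [run_cons, ← List.take_append_drop t l, run_append]
    have h1 := hc (.loop i c :: k) (l.take t) (by simp [hl])
    have h2 := hd k (l.drop t) (by simp [hl])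
    have : step O b (.loop i c :: k, s) = (c :: .loop i c :: k, s) := by
      obtain ⟨a, u, hu⟩ := List.exists_cons_of_ne_nil hi
      simp [step, hu]
    rw [this, h1, h2]

end Exec

lemma runDet_eq_run (O : Str → Bool) (T : ℕ) (κ : Cfg) :
    (step O false)^[T] κ = run O (List.replicate T false) κ := by
  induction T generalizing κ with
  | zero => rfl
  | succ T ih => simp [List.replicate_succ, ih]

lemma Exec.runDet {O : Str → Bool} {c : Prog} {s s' : Store} {T : ℕ} (h : Exec O c s s' T) :
    runDet O c s T = ([], s') := by
  obtain ⟨t, ht, h⟩ := h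
  obtain ⟨u, rfl⟩ := Nat.exists_eq_add_of_le ht
  rw [RelComplexity.runDet, runDet_eq_run, List.replicate_add, run_append, h [] _ (by simp),
    run_halted]

/-! ### Average over the coins -/

/-- The expectation of `f` of the final store, over `T` fair coins. -/
noncomputable def ev (O : Str → Bool) (f : Store → ℝ) : ℕ → Cfg → ℝ
  | 0, κ => f κ.2
  | T + 1, κ => (ev O f T (step O false κ) + ev O f T (step O true κ)) / 2

lemma ev_halted (O : Str → Bool) (f : Store → ℝ) (T : ℕ) (s : Store) :
    ev O f T ([], s) = f s := by
  induction T with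
  | zero => rfl
  | succ T ih => simp [ev, step, ih]

lemma ev_affine (O : Str → Bool) (f g : Store → ℝ) (a b c : ℝ) (T : ℕ) (κ : Cfg) :
    ev O (fun s => a + b * f s + c * g s) T κ = a + b * ev O f T κ + c * ev O g T κ := by
  induction T generalizing κ with
  | zero => rfl
  | succ T ih => simp only [ev, ih]; ring

lemma ev_const (O : Str → Bool) (a : ℝ) (T : ℕ) (κ : Cfg) : ev O (fun _ => a) T κ = a := by
  induction T generalizing κ with
  | zero => rfl
  | succ T ih => simp only [ev, ih]; ring

lemma ev_mono (O : Str → Bool) {f g : Store → ℝ} (h : ∀ s, f s ≤ g s) (T : ℕ) (κ : Cfg) :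
    ev O f T κ ≤ ev O g T κ := by
  induction T generalizing κ with
  | zero => exact h _
  | succ T ih =>
    have h1 := ih (step O false κ)
    have h2 := ih (step O true κ)
    simp only [ev]
    linarith

lemma ev_eq_sum (O : Str → Bool) (f : Store → ℝ) (T : ℕ) (κ : Cfg) :
    ev O f T κ = (∑ r : Fin T → Bool, f (run O (List.ofFn r) κ).2) / 2 ^ T := by
  induction T generalizing κ with
  | zero => simp [ev]
  | succ T ih =>
    have : ∑ r : Fin (T + 1) → Bool, f (run O (List.ofFn r) κ).2 =
        ∑ p : Bool × (Fin T → Bool), f (run O (List.ofFn p.2) (step O p.1 κ)).2 := by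
      refine (Fintype.sum_equiv (Fin.consEquiv fun _ => Bool) _ _ fun p => ?_).symm
      simp [Fin.consEquiv, List.ofFn_succ]
    rw [this, Fintype.sum_prod_type, Fintype.sum_bool, ev, ih, ih, pow_succ]
    field_simp
    ring

open Classical in
/-- The probability of an event about the output is the expectation of its indicator. -/
lemma prob_eq_ev (c : Prog) (s : Store) (T : ℕ) (E : Set Str) :
    prob c s T E = ev noOracle (fun s' => if s' 0 ∈ E then 1 else 0) T ([c], s) := by
  rw [ev_eq_sum, prob]
  congr 1
  rw [Finset.sum_boole, Nat.card_eq_fintype_card, Fintype.card_subtype]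
  rfl

/-- Within `T` steps the machine halts for all coins, and `f` of the final store has expectation
`v`. -/
def Val (O : Str → Bool) (f : Store → ℝ) (T : ℕ) (κ : Cfg) (v : ℝ) : Prop :=
  (∀ l : List Bool, l.length = T → (run O l κ).1 = []) ∧ ev O f T κ = v

namespace Val

variable {O : Str → Bool} {f : Store → ℝ} {T T' : ℕ} {κ : Cfg} {v : ℝ}

lemma halted (s : Store) : Val O f T ([], s) (f s) :=
  ⟨fun l _ => by simp, ev_halted _ _ _ _⟩

lemma succ_iff : Val O f (T + 1) κ v ↔
    ∃ v₀ v₁, Val O f T (step O false κ) v₀ ∧ Val O f T (step O true κ) v₁ ∧ (v₀ + v₁) / 2 = v := by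
  constructor
  · rintro ⟨h, rfl⟩
    exact ⟨_, _, ⟨fun l hl => h (false :: l) (by simpa using hl), rfl⟩,
      ⟨fun l hl => h (true :: l) (by simpa using hl), rfl⟩, rfl⟩
  · rintro ⟨v₀, v₁, ⟨h, rfl⟩, ⟨h', rfl⟩, rfl⟩
    refine ⟨fun l hl => ?_, rfl⟩
    match l with
    | [] => simp at hl
    | false :: l => exact h l (by simpa using hl)
    | true :: l => exact h' l (by simpa using hl)

lemma zero_iff : Val O f 0 κ v ↔ κ.1 = [] ∧ f κ.2 = v := by
  simp [Val, ev]

lemma mono (h : Val O f T κ v) (hT : T ≤ T') : Val O f T' κ v := by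
  induction T generalizing T' κ v with
  | zero =>
    obtain ⟨hk, rfl⟩ := zero_iff.1 h
    obtain ⟨k, s⟩ := κ
    subst hk
    exact halted s
  | succ T ih =>
    obtain ⟨T', rfl⟩ : ∃ U, T' = U + 1 := ⟨T' - 1, by omega⟩
    obtain ⟨v₀, v₁, h₀, h₁, rfl⟩ := succ_iff.1 h
    exact succ_iff.2 ⟨v₀, v₁, ih h₀ (by omega), ih h₁ (by omega), rfl⟩

lemma of_steps {t : ℕ} {κ' : Cfg} (hs : ∀ l : List Bool, l.length = t → run O l κ = κ')
    (h : Val O f T κ' v) : Val O f (t + T) κ v := by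
  induction t generalizing κ with
  | zero =>
    have := hs [] rfl
    simp only [run_nil] at this
    simpa [this] using h
  | succ t ih =>
    rw [Nat.add_right_comm]
    refine succ_iff.2 ⟨v, v, ih fun l hl => hs (false :: l) (by simpa using hl),
      ih fun l hl => hs (true :: l) (by simpa using hl), by ring⟩

lemma exec {c : Prog} {s s' : Store} {k : List Prog} {T' : ℕ} (hc : Exec O c s s' T')
    (h : Val O f T (k, s') v) : Val O f (T' + T) (c :: k, s) v := by
  obtain ⟨t, ht, hc⟩ := hc
  exact (of_steps (hc k) h).mono (by omega)

/-- Sequential composition: the expectation after `l ++ k` is the expectation, over the runs of `l`,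
of the expectation after `k`. -/
lemma append {l k : List Prog} {s : Store} {g : Store → ℝ} {T T' : ℕ}
    (hl : ∀ r : List Bool, r.length = T → (run O r (l, s)).1 = [])
    (hk : ∀ r : List Bool, r.length = T →
      Val O f T' (k, (run O r (l, s)).2) (g (run O r (l, s)).2)) :
    Val O f (T + T') (l ++ k, s) (ev O g T (l, s)) := by
  induction T generalizing l s with
  | zero =>
    have h1 := hl [] rfl
    have h2 := hk [] rfl
    simp only [run_nil] at h1 h2
    subst h1
    simpa [ev] using h2
  | succ T ih =>
    cases l with
    | nil =>
      rw [ev_halted]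
      have h2 := hk (List.replicate (T + 1) false) (by simp)
      simp only [run_halted] at h2
      exact h2.mono (by omega)
    | cons c l =>
      rw [Nat.add_right_comm]
      refine succ_iff.2 ⟨_, _, ?_, ?_, rfl⟩
      · rw [step_append]
        exact ih (fun r hr => hl (false :: r) (by simpa using hr))
          (fun r hr => hk (false :: r) (by simpa using hr))
      · rw [step_append]
        exact ih (fun r hr => hl (true :: r) (by simpa using hr))
          (fun r hr => hk (true :: r) (by simpa using hr))

end Val

/-! ### Programs using only the first `K` stacks -/

/-- All stack indices in the program are less than `K`. -/
def Prog.Below (K : ℕ) : Prog → Prop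
  | .skip => True
  | .push i _ => i < K
  | .pop i => i < K
  | .toss i => i < K
  | .query q i => q < K ∧ i < K
  | .seq c d => c.Below K ∧ d.Below K
  | .branch i c₁ c₀ cₑ => i < K ∧ c₁.Below K ∧ c₀.Below K ∧ cₑ.Below K
  | .loop i c => i < K ∧ c.Below K

lemma Prog.Below.mono {K K' : ℕ} (hK : K ≤ K') : ∀ {c : Prog}, c.Below K → c.Below K'
  | .skip, _ => trivial
  | .push _ _, h => lt_of_lt_of_le h hK
  | .pop _, h => lt_of_lt_of_le h hK
  | .toss _, h => lt_of_lt_of_le h hK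
  | .query _ _, h => ⟨h.1.trans_le hK, h.2.trans_le hK⟩
  | .seq _ _, h => ⟨h.1.mono hK, h.2.mono hK⟩
  | .branch _ _ _ _, h =>
    ⟨h.1.trans_le hK, h.2.1.mono hK, h.2.2.1.mono hK, h.2.2.2.mono hK⟩
  | .loop _ _, h => ⟨h.1.trans_le hK, h.2.mono hK⟩

lemma Prog.exists_below (c : Prog) : ∃ K, 2 ≤ K ∧ c.Below K := by
  suffices h : ∃ K, c.Below K by
    obtain ⟨K, h⟩ := h
    exact ⟨max 2 K, le_max_left _ _, h.mono (le_max_right _ _)⟩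
  induction c with
  | skip => exact ⟨0, trivial⟩
  | push i b => exact ⟨i + 1, Nat.lt_succ_self i⟩
  | pop i => exact ⟨i + 1, Nat.lt_succ_self i⟩
  | toss i => exact ⟨i + 1, Nat.lt_succ_self i⟩
  | query q i => exact ⟨q + i + 1, by simp only [Prog.Below]; omega⟩
  | seq c d hc hd =>
    obtain ⟨K, hK⟩ := hc
    obtain ⟨K', hK'⟩ := hd
    exact ⟨K + K', hK.mono (by omega), hK'.mono (by omega)⟩
  | branch i c d e hc hd he =>
    obtain ⟨K, hK⟩ := hc
    obtain ⟨K', hK'⟩ := hd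
    obtain ⟨K'', hK''⟩ := he
    exact ⟨i + 1 + K + K' + K'', by omega, hK.mono (by omega), hK'.mono (by omega),
      hK''.mono (by omega)⟩
  | loop i c hc =>
    obtain ⟨K, hK⟩ := hc
    exact ⟨i + 1 + K, by omega, hK.mono (by omega)⟩

/-- The store whose stacks `0, …, K - 1` are those of `a`, followed by the stacks listed in `l`. -/
def mk (K : ℕ) (a : Store) (l : List Str) : Store :=
  fun i => if i < K then a i else l.getD (i - K) []

lemma mk_lo {K i : ℕ} (h : i < K) (a : Store) (l : List Str) : mk K a l i = a i := if_pos h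

@[simp] lemma mk_hi (K j : ℕ) (a : Store) (l : List Str) : mk K a l (K + j) = l.getD j [] := by
  simp [mk]

lemma update_mk_lo {K i : ℕ} (h : i < K) (a : Store) (l : List Str) (v : Str) :
    Function.update (mk K a l) i v = mk K (Function.update a i v) l := by
  funext n
  by_cases hn : n = i
  · subst hn; simp [mk, h]
  · simp [mk, hn]

lemma update_mk_hi {K j : ℕ} {l : List Str} (h : j < l.length) (a : Store) (v : Str) :
    Function.update (mk K a l) (K + j) v = mk K a (l.set j v) := by
  funext n
  by_cases hn : n = K + j
  · subst hn; simp [mk, h]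
  · rw [Function.update_of_ne hn]
    by_cases hK : n < K
    · simp [mk, hK]
    · simp only [mk, hK, if_false, List.getD_eq_getElem?_getD]
      rw [List.getElem?_set_ne (by omega)]

lemma mk_congr {K : ℕ} {a a' : Store} (h : ∀ i < K, a i = a' i) (l : List Str) :
    mk K a l = mk K a' l := by
  funext n
  by_cases hn : n < K <;> simp [mk, hn, h]

/-- A program that uses only the first `K` stacks neither reads nor changes the others. -/
lemma step_mk (O : Str → Bool) (b : Bool) {K : ℕ} {k : List Prog} (hk : ∀ c ∈ k, c.Below K)
    (a : Store) (l : List Str) :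
    step O b (k, mk K a l) = ((step O b (k, a)).1, mk K (step O b (k, a)).2 l) ∧
      ∀ c ∈ (step O b (k, a)).1, c.Below K := by
  cases k with
  | nil => simp [step]
  | cons c k =>
    have hc : c.Below K := hk c (by simp)
    have hk' : ∀ c ∈ k, c.Below K := fun d hd => hk d (by simp [hd])
    cases c with
    | skip => exact ⟨rfl, hk'⟩
    | push i a' => exact ⟨by simp [step, update_mk_lo hc, mk_lo hc], hk'⟩
    | pop i => exact ⟨by simp [step, update_mk_lo hc, mk_lo hc], hk'⟩
    | toss i => exact ⟨by simp [step, update_mk_lo hc, mk_lo hc], hk'⟩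
    | query q i => exact ⟨by simp [step, update_mk_lo hc.2, mk_lo hc.2, mk_lo hc.1], hk'⟩
    | seq c d =>
      refine ⟨rfl, fun e he => ?_⟩
      simp only [step, List.mem_cons] at he
      rcases he with rfl | rfl | he
      exacts [hc.1, hc.2, hk' e he]
    | branch i c₁ c₀ cₑ =>
      have hi := mk_lo hc.1 a l
      rcases h : a i with _ | ⟨_ | _, u⟩ <;> rw [h] at hi <;>
        refine ⟨by simp [step, h, hi], fun e he => ?_⟩ <;>
        simp only [step, h, List.mem_cons] at he <;> rcases he with rfl | he
      exacts [hc.2.2.2, hk' e he, hc.2.2.1, hk' e he, hc.2.1, hk' e he]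
    | loop i c =>
      have hi := mk_lo hc.1 a l
      rcases h : a i with _ | ⟨_, u⟩ <;> rw [h] at hi <;>
        refine ⟨by simp [step, h, hi], fun e he => ?_⟩ <;>
        simp only [step, h, List.mem_cons] at he
      · exact hk' e he
      · rcases he with rfl | rfl | he
        exacts [hc.2, hc, hk' e he]

lemma run_mk (O : Str → Bool) {K : ℕ} (r : List Bool) {k : List Prog} (hk : ∀ c ∈ k, c.Below K)
    (a : Store) (l : List Str) :
    run O r (k, mk K a l) = ((run O r (k, a)).1, mk K (run O r (k, a)).2 l) := by
  induction r generalizing k a with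
  | nil => rfl
  | cons b r ih =>
    obtain ⟨h1, h2⟩ := step_mk O b hk a l
    rw [run_cons, run_cons, h1, ih h2]

lemma ev_mk (O : Str → Bool) (f : Store → ℝ) {K : ℕ} (T : ℕ) {k : List Prog}
    (hk : ∀ c ∈ k, c.Below K) (a : Store) (l : List Str) :
    ev O f T (k, mk K a l) = ev O (fun s => f (mk K s l)) T (k, a) := by
  induction T generalizing k a with
  | zero => rfl
  | succ T ih =>
    obtain ⟨h1, h2⟩ := step_mk O false hk a l
    obtain ⟨h3, h4⟩ := step_mk O true hk a l
    rw [ev, ev, h1, h3, ih h2, ih h4]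

/-- In one step a stack grows by at most one bit. -/
lemma length_step_le (O : Str → Bool) (b : Bool) (κ : Cfg) (i : ℕ) :
    ((step O b κ).2 i).length ≤ (κ.2 i).length + 1 := by
  have key : ∀ (s : Store) (j : ℕ) (v : Str), v.length ≤ (s j).length + 1 →
      (Function.update s j v i).length ≤ (s i).length + 1 := by
    intro s j v hv
    by_cases hj : i = j
    · subst hj; simpa using hv
    · simp [hj]
  obtain ⟨_ | ⟨c, k⟩, s⟩ := κ
  · simp [step]
  · cases c with
    | push j a => exact key s j _ (by simp)
    | pop j => exact key s j _ (by simp; omega)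
    | toss j => exact key s j _ (by simp)
    | query q j => exact key s j _ (by simp)
    | skip => simp [step]
    | seq c d => simp [step]
    | branch j c₁ c₀ cₑ => simp only [step]; split <;> simp
    | loop j c => simp only [step]; split <;> simp

lemma length_run_le (O : Str → Bool) (r : List Bool) (κ : Cfg) (i : ℕ) :
    ((run O r κ).2 i).length ≤ (κ.2 i).length + r.length := by
  induction r generalizing κ with
  | nil => simp
  | cons b r ih =>
    have h1 := ih (step O b κ)
    have h2 := length_step_le O b κ i
    simp only [run_cons, List.length_cons]
    omega

lemma step_tossFree (O : Str → Bool) (b : Bool) {k : List Prog} (hk : ∀ c ∈ k, c.TossFree)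
    (s : Store) : step O b (k, s) = step O false (k, s) ∧
      ∀ c ∈ (step O false (k, s)).1, c.TossFree := by
  cases k with
  | nil => simp [step]
  | cons c k =>
    have hc : c.TossFree := hk c (by simp)
    have hk' : ∀ c ∈ k, c.TossFree := fun d hd => hk d (by simp [hd])
    cases c with
    | skip => exact ⟨rfl, hk'⟩
    | push i a' => exact ⟨rfl, hk'⟩
    | pop i => exact ⟨rfl, hk'⟩
    | toss i => exact hc.elim
    | query q i => exact ⟨rfl, hk'⟩
    | seq c d =>
      refine ⟨rfl, fun e he => ?_⟩
      simp only [step, List.mem_cons] at he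
      rcases he with rfl | rfl | he
      exacts [hc.1, hc.2, hk' e he]
    | branch i c₁ c₀ cₑ =>
      rcases h : s i with _ | ⟨_ | _, u⟩ <;>
        refine ⟨by simp [step, h], fun e he => ?_⟩ <;>
        simp only [step, h, List.mem_cons] at he <;> rcases he with rfl | he
      exacts [hc.2.2, hk' e he, hc.2.1, hk' e he, hc.1, hk' e he]
    | loop i c =>
      rcases h : s i with _ | ⟨_, u⟩ <;>
        refine ⟨by simp [step, h], fun e he => ?_⟩ <;>
        simp only [step, h, List.mem_cons] at he
      · exact hk' e he
      · rcases he with rfl | rfl | he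
        exacts [hc, hc, hk' e he]

/-- Without queries the oracle is irrelevant. -/
lemma step_queryFree (O : Str → Bool) (b : Bool) {k : List Prog} (hk : ∀ c ∈ k, c.QueryFree)
    (s : Store) : step O b (k, s) = step noOracle b (k, s) ∧
      ∀ c ∈ (step noOracle b (k, s)).1, c.QueryFree := by
  cases k with
  | nil => simp [step]
  | cons c k =>
    have hc : c.QueryFree := hk c (by simp)
    have hk' : ∀ c ∈ k, c.QueryFree := fun d hd => hk d (by simp [hd])
    cases c with
    | skip => exact ⟨rfl, hk'⟩
    | push i a' => exact ⟨rfl, hk'⟩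
    | pop i => exact ⟨rfl, hk'⟩
    | toss i => exact ⟨rfl, hk'⟩
    | query q i => exact hc.elim
    | seq c d =>
      refine ⟨rfl, fun e he => ?_⟩
      simp only [step, List.mem_cons] at he
      rcases he with rfl | rfl | he
      exacts [hc.1, hc.2, hk' e he]
    | branch i c₁ c₀ cₑ =>
      rcases h : s i with _ | ⟨_ | _, u⟩ <;>
        refine ⟨by simp [step, h], fun e he => ?_⟩ <;>
        simp only [step, h, List.mem_cons] at he <;> rcases he with rfl | he
      exacts [hc.2.2, hk' e he, hc.2.1, hk' e he, hc.1, hk' e he]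
    | loop i c =>
      rcases h : s i with _ | ⟨_, u⟩ <;>
        refine ⟨by simp [step, h], fun e he => ?_⟩ <;>
        simp only [step, h, List.mem_cons] at he
      · exact hk' e he
      · rcases he with rfl | rfl | he
        exacts [hc, hc, hk' e he]

/-- A halting deterministic computation can be carried out in the midst of another one. -/
lemma exists_steps_append (O : Str → Bool) {T : ℕ} {l : List Prog} {s : Store}
    (ht : ∀ c ∈ l, c.TossFree) (hl : ((step O false)^[T] (l, s)).1 = []) :
    ∃ t ≤ T, ∀ (k : List Prog) (r : List Bool), r.length = t →
      run O r (l ++ k, s) = (k, ((step O false)^[T] (l, s)).2) := by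
  induction T generalizing l s with
  | zero =>
    obtain rfl : l = [] := hl
    refine ⟨0, le_rfl, fun k r hr => ?_⟩
    obtain rfl := List.length_eq_zero_iff.1 hr
    rfl
  | succ T ih =>
    cases l with
    | nil =>
      refine ⟨0, by omega, fun k r hr => ?_⟩
      obtain rfl := List.length_eq_zero_iff.1 hr
      rw [runDet_eq_run, run_halted]
      rfl
    | cons c l =>
      rw [Function.iterate_succ_apply] at hl ⊢
      obtain ⟨t, htT, h⟩ := ih (step_tossFree O false ht s).2 hl
      refine ⟨t + 1, by omega, fun k r hr => ?_⟩
      cases r with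
      | nil => simp at hr
      | cons b r =>
        rw [run_cons, step_append, (step_tossFree O b ht s).1]
        exact h k r (by simpa using hr)

/-- Running, on the first `K` stacks, a deterministic oracle-free program that uses only these. -/
lemma Exec.of_haltsDet (O : Str → Bool) {c : Prog} {K T : ℕ} {s : Store} (hK : c.Below K)
    (ht : c.TossFree) (hq : c.QueryFree) (h : HaltsDet noOracle c s T) (l : List Str) :
    Exec O c (mk K s l) (mk K (RelComplexity.runDet noOracle c s T).2 l) T := by
  have hq' : ∀ (T : ℕ) (k : List Prog) (s : Store), (∀ c ∈ k, c.QueryFree) →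
      (step O false)^[T] (k, s) = (step noOracle false)^[T] (k, s) := by
    intro T
    induction T with
    | zero => intros; rfl
    | succ T ih =>
      intro k s hk
      obtain ⟨h1, h2⟩ := step_queryFree O false hk s
      rw [Function.iterate_succ_apply, Function.iterate_succ_apply, h1, ← ih _ _ h2]
  have e : (step O false)^[T] ([c], mk K s l) =
      ((RelComplexity.runDet noOracle c s T).1,
        mk K (RelComplexity.runDet noOracle c s T).2 l) := by
    rw [runDet_eq_run, run_mk _ _ (by simpa using hK), ← runDet_eq_run,
      hq' _ _ _ (by simpa using hq)]
    rfl
  obtain ⟨t, htT, h'⟩ := exists_steps_append O (l := [c]) (s := mk K s l) (T := T)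
    (by simpa using ht) (by rw [e]; exact h)
  refine ⟨t, htT, fun k r hr => ?_⟩
  have := h' k r hr
  rw [e] at this
  exact this

/-! ### Subroutines -/

/-- Push the word `w` on stack `j`, so that the head of `w` becomes the top. -/
def pushWord (j : ℕ) : Str → Prog
  | [] => .skip
  | b :: w => .seq (pushWord j w) (.push j b)

/-- Remove the bits of stack `i` one by one, running `e b` after the removal of the bit `b`. -/
def drain (i : ℕ) (e : Bool → Prog) : Prog :=
  .loop i (.branch i (.seq (.pop i) (e true)) (.seq (.pop i) (e false)) .skip)

/-- Empty stack `i`. -/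
def clear (i : ℕ) : Prog := .loop i (.pop i)

/-- Empty the stacks `0, …, K - 1`. -/
def clearBelow : ℕ → Prog
  | 0 => .skip
  | K + 1 => .seq (clearBelow K) (clear K)

/-- Move the contents of stack `i` to stack `j`, replacing each bit `b` by the word `w b`; the order
is reversed. -/
def xfer (i j : ℕ) (w : Bool → Str) : Prog := drain i fun b => pushWord j (w b)

/-- Put a copy of stack `i`, with each bit `b` replaced by the word `w b`, on top of stack `j`,
using the empty stack `t`. -/
def copy (i t j : ℕ) (w : Bool → Str) : Prog :=
  .seq (xfer i t fun b => [b]) (drain t fun b => .seq (.push i b) (pushWord j (w b)))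

/-- Remove the zeros on top of stack `i` and the first one below them, using the empty
stack `h`. -/
def dropZeros (i h : ℕ) : Prog :=
  .seq (.push h true) (.loop h (.branch i (.seq (.pop i) (.pop h)) (.pop i) (.pop h)))

/-- The word `u` without its leading zeros and the first one after them. -/
def decode : Str → Str
  | [] => []
  | true :: u => u
  | false :: u => decode u

/-- The result of folding a state along a word; the step also sees the rest of the word. -/
def drainFold {σ : Type*} (g : Bool → Str → σ → σ) : Str → σ → σ
  | [], st => st
  | b :: u, st => drainFold g u (g b u st)

@[simp] lemma tossFree_pushWord (j : ℕ) (w : Str) : (pushWord j w).TossFree := by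
  induction w <;> simp_all [pushWord, Prog.TossFree]

@[simp] lemma queryFree_pushWord (j : ℕ) (w : Str) : (pushWord j w).QueryFree := by
  induction w <;> simp_all [pushWord, Prog.QueryFree]

@[simp] lemma tossFree_drain (i : ℕ) (e : Bool → Prog) :
    (drain i e).TossFree ↔ ∀ b, (e b).TossFree := by
  simp [drain, Prog.TossFree, and_comm]

@[simp] lemma queryFree_drain (i : ℕ) (e : Bool → Prog) :
    (drain i e).QueryFree ↔ ∀ b, (e b).QueryFree := by
  simp [drain, Prog.QueryFree, and_comm]

@[simp] lemma tossFree_clear (i : ℕ) : (clear i).TossFree := by simp [clear, Prog.TossFree]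

@[simp] lemma queryFree_clear (i : ℕ) : (clear i).QueryFree := by simp [clear, Prog.QueryFree]

@[simp] lemma tossFree_clearBelow (K : ℕ) : (clearBelow K).TossFree := by
  induction K <;> simp_all [clearBelow, Prog.TossFree]

@[simp] lemma queryFree_clearBelow (K : ℕ) : (clearBelow K).QueryFree := by
  induction K <;> simp_all [clearBelow, Prog.QueryFree]

@[simp] lemma tossFree_xfer (i j : ℕ) (w : Bool → Str) : (xfer i j w).TossFree := by
  simp [xfer]

@[simp] lemma queryFree_xfer (i j : ℕ) (w : Bool → Str) : (xfer i j w).QueryFree := by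
  simp [xfer]

@[simp] lemma tossFree_copy (i t j : ℕ) (w : Bool → Str) : (copy i t j w).TossFree := by
  simp [copy, Prog.TossFree]

@[simp] lemma queryFree_copy (i t j : ℕ) (w : Bool → Str) : (copy i t j w).QueryFree := by
  simp [copy, Prog.QueryFree]

@[simp] lemma tossFree_dropZeros (i h : ℕ) : (dropZeros i h).TossFree := by
  simp [dropZeros, Prog.TossFree]

@[simp] lemma queryFree_dropZeros (i h : ℕ) : (dropZeros i h).QueryFree := by
  simp [dropZeros, Prog.QueryFree]

namespace Exec

variable {O : Str → Bool} {s : Store}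

lemma pushWord (j : ℕ) (w : Str) :
    Exec O (pushWord j w) s (Function.update s j (w ++ s j)) (2 * w.length + 1) := by
  induction w with
  | nil => exact skip.cast (by simp) (by simp)
  | cons b w ih => exact (ih.seq (push j b)).cast (by simp) (by simp; omega)

/-- The rule for `drain`: `S u st` is the store when `u` is left on stack `i` and the other stacks
are as described by `st`. -/
lemma drain {σ : Type*} {i : ℕ} {e : Bool → Prog} {S : Str → σ → Store}
    {g : Bool → Str → σ → σ} (Inv : Str → σ → Prop) {τ : ℕ} (hS : ∀ u st, S u st i = u)
    (he : ∀ b u st, Inv (b :: u) st →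
      Exec O (e b) (Function.update (S (b :: u) st) i u) (S u (g b u st)) τ ∧ Inv u (g b u st))
    (u : Str) (st : σ) (hI : Inv u st) :
    Exec O (drain i e) (S u st) (S [] (drainFold g u st)) ((τ + 4) * u.length + 1) := by
  induction u generalizing st with
  | nil => exact (loop_nil (hS _ _)).cast rfl (by simp)
  | cons b u ih =>
    obtain ⟨h, hI'⟩ := he b u st hI
    have hp : Exec O (.pop i) (S (b :: u) st) (Function.update (S (b :: u) st) i u) 1 :=
      (pop i).cast (by simp [hS]) le_rfl
    have hb : Exec O (.branch i (.seq (.pop i) (e true)) (.seq (.pop i) (e false)) .skip)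
        (S (b :: u) st) (S u (g b u st)) (τ + 3) := by
      cases b with
      | false => exact (branch_false (hS _ _) (hp.seq h)).mono (by omega)
      | true => exact (branch_true (hS _ _) (hp.seq h)).mono (by omega)
    refine (loop_cons (by simp [hS]) hb (ih _ hI')).cast rfl ?_
    rw [List.length_cons]
    ring_nf
    omega

lemma clear (i : ℕ) :
    Exec O (clear i) s (Function.update s i []) (2 * (s i).length + 1) := by
  obtain ⟨u, hu⟩ : ∃ u, u = s i := ⟨_, rfl⟩
  rw [← hu]
  induction u generalizing s with
  | nil => exact (loop_nil hu.symm).cast (by simp [hu]) (by simp)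
  | cons b u ih =>
    refine (loop_cons (by simp [← hu]) (pop i) (ih (by simp [← hu]))).cast (by simp) ?_
    simp only [List.length_cons]; omega

lemma clearBelow {K B : ℕ} {a : Store} {l : List Str} (hB : ∀ i < K, (a i).length ≤ B) :
    Exec O (clearBelow K) (mk K a l) (mk K (fun _ => []) l) (K * (2 * B + 2) + 1) := by
  suffices h : ∀ k ≤ K, Exec O (RelComplexity.clearBelow k) (mk K a l)
      (mk K (fun i => if i < k then [] else a i) l) (k * (2 * B + 2) + 1) by
    exact (h K le_rfl).cast (mk_congr (fun i hi => by simp [hi]) l) le_rfl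
  intro k
  induction k with
  | zero => exact fun _ => skip.cast (by simp) (by simp)
  | succ k ih =>
    intro hk
    refine ((ih (by omega)).seq (clear k)).cast ?_ ?_
    · rw [update_mk_lo (by omega)]
      refine mk_congr (fun i _ => ?_) l
      by_cases hik : i = k
      · simp [hik]
      · have : i < k + 1 ↔ i < k := by omega
        simp [hik, this]
    · rw [mk_lo (by omega)]
      have := hB k (by omega)
      simp only [lt_irrefl, if_false]
      rw [Nat.succ_mul k]
      omega

lemma xfer {i j : ℕ} (hij : i ≠ j) {w : Bool → Str} {n : ℕ} (hw : ∀ b, (w b).length ≤ n) :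
    Exec O (xfer i j w) s
      (Function.update (Function.update s i []) j ((s i).foldl (fun acc b => w b ++ acc) (s j)))
      ((2 * n + 5) * (s i).length + 1) := by
  have h := drain (O := O) (i := i) (e := fun b => RelComplexity.pushWord j (w b)) (τ := 2 * n + 1)
    (S := fun u acc => Function.update (Function.update s i u) j acc)
    (g := fun b _ acc => w b ++ acc) (fun _ _ => True) (by simp [hij])
    (fun b u acc _ => ⟨(pushWord j (w b)).cast ?_ (by have := hw b; omega), trivial⟩)
    (s i) (s j) trivial
  · have hf : ∀ (u : Str) (acc : Str), drainFold (fun b _ acc => w b ++ acc) u acc =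
        u.foldl (fun acc b => w b ++ acc) acc := by
      intro u
      induction u with
      | nil => intro _; rfl
      | cons b u ih => intro acc; exact ih _
    simp only [Function.update_eq_self, hf] at h
    exact h
  · funext n
    by_cases h1 : n = j
    · subst h1; simp [hij.symm]
    · by_cases h2 : n = i
      · subst h2; simp [hij]
      · simp [h1, h2]

lemma move {i j : ℕ} (hij : i ≠ j) : Exec O (RelComplexity.xfer i j fun b => [b]) s
    (Function.update (Function.update s i []) j ((s i).reverse ++ s j))
    (7 * (s i).length + 1) := by
  refine (xfer hij (n := 1) (by simp)).cast ?_ (by omega)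
  simp

lemma copy {i t j : ℕ} (hit : i ≠ t) (hij : i ≠ j) (htj : t ≠ j) {w : Bool → Str} {n : ℕ}
    (hw : ∀ b, (w b).length ≤ n) (ht : s t = []) :
    Exec O (copy i t j w) s (Function.update s j ((s i).flatMap w ++ s j))
      ((2 * n + 14) * (s i).length + 3) := by
  have h := drain (O := O) (i := t)
    (e := fun b => .seq (.push i b) (RelComplexity.pushWord j (w b))) (τ := 2 * n + 3)
    (S := fun u (p : Str × Str) =>
      Function.update (Function.update (Function.update s t u) i p.1) j p.2)
    (g := fun b _ p => (b :: p.1, w b ++ p.2)) (fun _ _ => True) (by simp [hit.symm, htj])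
    (fun b u p _ => ⟨((push i b).seq (pushWord j (w b))).cast ?_ (by have := hw b; omega), trivial⟩)
    (s i).reverse ([], s j) trivial
  · have hf : ∀ (u : Str) (p : Str × Str),
        drainFold (fun b _ (p : Str × Str) => (b :: p.1, w b ++ p.2)) u p =
        (u.reverse ++ p.1, u.reverse.flatMap w ++ p.2) := by
      intro u
      induction u with
      | nil => intro _; rfl
      | cons b u ih => intro p; simp [drainFold, ih]
    rw [hf] at h
    have hs : Function.update (Function.update (Function.update s t (s i).reverse) i []) j (s j) =
        Function.update (Function.update s i []) t ((s i).reverse ++ s t) := by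
      funext n
      simp only [Function.update_apply, ht, List.append_nil]
      split_ifs <;> simp_all
    rw [hs] at h
    refine ((move hit).seq h).cast ?_ (by simp only [List.length_reverse]; ring_nf; omega)
    funext n
    simp only [Function.update_apply, List.reverse_reverse, List.append_nil]
    split_ifs <;> simp_all
  · funext n
    simp only [Function.update_apply]
    split_ifs <;> simp_all

lemma dropZeros {i h : ℕ} (hih : i ≠ h) (hh : s h = []) :
    Exec O (dropZeros i h) s (Function.update s i (decode (s i))) (4 * (s i).length + 8) := by
  set B : Prog := .branch i (.seq (.pop i) (.pop h)) (.pop i) (.pop h) with hB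
  have key : ∀ (u : Str) (s : Store), s h = [true] → s i = u →
      Exec O (.loop h B) s (Function.update (Function.update s i (decode u)) h [])
        (4 * u.length + 6) := by
    intro u
    induction u with
    | nil =>
      intro s hs hi
      refine (loop_cons (by simp [hs]) (branch_nil hi (pop h)) (loop_nil (by simp [hs]))).cast
        ?_ (by simp)
      funext n
      simp only [Function.update_apply]
      split_ifs <;> simp_all [decode]
    | cons b u ih =>
      intro s hs hi
      cases b with
      | true =>
        refine (loop_cons (by simp [hs]) (branch_true hi ((pop i).seq (pop h)))
          (loop_nil (by simp [hs, hih.symm]))).cast ?_ (by simp only [List.length_cons]; omega)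
        funext n
        simp only [Function.update_apply]
        split_ifs <;> simp_all [decode]
      | false =>
        refine (loop_cons (by simp [hs]) (branch_false hi (pop i))
          (ih _ (by simp [hs, hih.symm]) (by simp [hi]))).cast ?_
          (by simp only [List.length_cons]; omega)
        funext n
        simp only [Function.update_apply]
        split_ifs <;> simp_all [decode]
  refine ((push h true).seq (key (s i) _ (by simp [hh]) (by simp [hih]))).cast ?_ (by omega)
  funext n
  simp only [Function.update_apply]
  split_ifs <;> simp_all

end Exec
lemma mk_hi_zero (K : ℕ) (a : Store) (l : List Str) : mk K a l K = l.getD 0 [] := mk_hi K 0 a l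

lemma update_mk_hi_zero {K : ℕ} {l : List Str} (h : 0 < l.length) (a : Store) (v : Str) :
    Function.update (mk K a l) K v = mk K a (l.set 0 v) := update_mk_hi (j := 0) h a v

lemma input_nil (w : Str) : input w [] = Function.update (fun _ => []) 0 w := by
  funext i
  match i with
  | 0 => simp [input]
  | 1 => simp [input]
  | i + 2 => simp [input]

/-! ### The sampler -/

/-! The sampler uses the stacks `0, …, K - 1` for a given program and the stacks `K, …, K + 8` for
its own data: the input `x`, the prefix `z`, the iteration counter, the unary accuracy parameter, the
output stream of the last sample, a work stack, a flag, a copy of the prefix, and the list of next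
bits seen, the latest on top. -/

/-- Parsing of an instance: pairs `1b` and `0b` put the bit `b` on the second and on the first
component. -/
def parse : Str → Str × Str → Str × Str
  | [], p => p
  | [_], p => p
  | t :: b :: w, p => parse w (if t then (p.1, b :: p.2) else (b :: p.1, p.2))

/-- Quadruple the counter. -/
def quadProg (K : ℕ) : Prog :=
  .seq (xfer (K + 2) (K + 5) fun b => [b, b, b, b]) (xfer (K + 5) (K + 2) fun b => [b])

/-- Parse the instance on stack `0`, quadrupling the counter for every pair of bits. -/
def parseProg (K : ℕ) : Prog :=
  .loop 0 (.seq
    (.branch 0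
      (.seq (.pop 0) (.branch 0 (.push (K + 1) true) (.push (K + 1) false) .skip))
      (.seq (.pop 0) (.branch 0 (.push K true) (.push K false) .skip))
      .skip)
    (.seq (.pop 0) (quadProg K)))

lemma exec_quadProg (O : Str → Bool) (K n : ℕ) (a : Store) (X Z M R H Y S : Str) :
    Exec O (quadProg K) (mk K a [X, Z, List.replicate n false, M, R, [], H, Y, S])
      (mk K a [X, Z, List.replicate (n * 4) false, M, R, [], H, Y, S]) (50 * n + 3) := by
  have h1 : Exec O (xfer (K + 2) (K + 5) fun b => [b, b, b, b])
      (mk K a [X, Z, List.replicate n false, M, R, [], H, Y, S])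
      (mk K a [X, Z, [], M, R, List.replicate (n * 4) false, H, Y, S]) (13 * n + 1) := by
    refine (Exec.xfer (by omega) (n := 4) (by simp)).cast ?_ (by simp)
    have : ∀ v : Str, List.foldl (fun acc b => b :: b :: b :: b :: acc) v
        (List.replicate n false) = List.replicate (n * 4) false ++ v := by
      intro v
      induction n generalizing v with
      | zero => simp
      | succ n ih =>
        rw [List.replicate_succ, List.foldl_cons, ih, Nat.succ_mul n, List.replicate_add]
        simp [List.replicate]
    simp [update_mk_hi, this]
  have h2 : Exec O (xfer (K + 5) (K + 2) fun b => [b])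
      (mk K a [X, Z, [], M, R, List.replicate (n * 4) false, H, Y, S])
      (mk K a [X, Z, List.replicate (n * 4) false, M, R, [], H, Y, S]) (28 * n + 1) :=
    (Exec.move (by omega)).cast (by simp [update_mk_hi]) (by simp; omega)
  exact (h1.seq h2).mono (by omega)

lemma exec_parseProg (O : Str → Bool) {K : ℕ} (hK : 0 < K) (w X Z M R H Y S : Str) (n : ℕ) :
    Exec O (parseProg K)
      (mk K (Function.update (fun _ => []) 0 w)
        [X, Z, List.replicate n false, M, R, [], H, Y, S])
      (mk K (fun _ => []) [(parse w (X, Z)).1, (parse w (X, Z)).2,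
        List.replicate (n * 4 ^ ((w.length + 1) / 2)) false, M, R, [], H, Y, S])
      (60 * n * 4 ^ w.length + 20 * w.length + 1) := by
  have tail : ∀ (v X Z : Str) (n : ℕ), Exec O (.seq (.pop 0) (quadProg K))
      (mk K (Function.update (fun _ => []) 0 v)
        [X, Z, List.replicate n false, M, R, [], H, Y, S])
      (mk K (Function.update (fun _ => []) 0 v.tail)
        [X, Z, List.replicate (n * 4) false, M, R, [], H, Y, S]) (50 * n + 5) := by
    intro v X Z n
    have := (Exec.pop (O := O) (s := mk K (Function.update (fun _ => []) 0 v)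
        [X, Z, List.replicate n false, M, R, [], H, Y, S]) 0).cast
        (s'' := mk K (Function.update (fun _ => []) 0 v.tail)
        [X, Z, List.replicate n false, M, R, [], H, Y, S])
        (by simp [update_mk_lo hK, mk_lo hK]) le_rfl
    exact (this.seq (exec_quadProg ..)).mono (by omega)
  generalize hp : (X, Z) = p
  obtain ⟨rfl, rfl⟩ : X = p.1 ∧ Z = p.2 := by simp [← hp]
  clear hp
  induction w, p using parse.induct generalizing n with
  | case1 p =>
    refine (Exec.loop_nil (by simp [mk_lo hK])).cast ?_ (by omega)
    simp [parse]
  | case2 b p =>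
    have hb : Exec O (.branch 0
        (.seq (.pop 0) (.branch 0 (.push (K + 1) true) (.push (K + 1) false) .skip))
        (.seq (.pop 0) (.branch 0 (.push K true) (.push K false) .skip)) .skip)
        (mk K (Function.update (fun _ => []) 0 [b])
          [p.1, p.2, List.replicate n false, M, R, [], H, Y, S])
        (mk K (Function.update (fun _ => []) 0 [])
          [p.1, p.2, List.replicate n false, M, R, [], H, Y, S]) 5 := by
      have hp := (Exec.pop (O := O) (s := mk K (Function.update (fun _ => []) 0 [b])
          [p.1, p.2, List.replicate n false, M, R, [], H, Y, S]) 0)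
      cases b with
      | true =>
        refine (Exec.branch_true (by simp [mk_lo hK]; rfl)
          (hp.seq (Exec.branch_nil (by simp [mk_lo hK]) Exec.skip))).cast ?_ (by omega)
        simp [mk_lo hK, update_mk_lo hK]
      | false =>
        refine (Exec.branch_false (by simp [mk_lo hK]; rfl)
          (hp.seq (Exec.branch_nil (by simp [mk_lo hK]) Exec.skip))).cast ?_ (by omega)
        simp [mk_lo hK, update_mk_lo hK]
    refine (Exec.loop_cons (by simp [mk_lo hK]) (hb.seq (tail [] _ _ n))
      (Exec.loop_nil (by simp [mk_lo hK]))).cast ?_ (by simp; omega)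
    simp [parse]
  | case3 t b w p ih =>
    have hb : Exec O (.branch 0
        (.seq (.pop 0) (.branch 0 (.push (K + 1) true) (.push (K + 1) false) .skip))
        (.seq (.pop 0) (.branch 0 (.push K true) (.push K false) .skip)) .skip)
        (mk K (Function.update (fun _ => []) 0 (t :: b :: w))
          [p.1, p.2, List.replicate n false, M, R, [], H, Y, S])
        (mk K (Function.update (fun _ => []) 0 (b :: w))
          [(if t then (p.1, b :: p.2) else (b :: p.1, p.2)).1,
            (if t then (p.1, b :: p.2) else (b :: p.1, p.2)).2,
            List.replicate n false, M, R, [], H, Y, S]) 5 := by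
      have hp := (Exec.pop (O := O) (s := mk K (Function.update (fun _ => []) 0 (t :: b :: w))
          [p.1, p.2, List.replicate n false, M, R, [], H, Y, S]) 0)
      cases t with
      | true =>
        refine (Exec.branch_true (by simp [mk_lo hK]; rfl) (hp.seq (T' := 2)
          (s'' := mk K (Function.update (fun _ => []) 0 (b :: w))
          [p.1, b :: p.2, List.replicate n false, M, R, [], H, Y, S]) ?_)).cast ?_ (by omega)
        · cases b with
          | true =>
            refine (Exec.branch_true (by simp [mk_lo hK]; rfl) (Exec.push _ _)).cast ?_ le_rfl
            simp [mk_lo hK, update_mk_lo hK, update_mk_hi]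
          | false =>
            refine (Exec.branch_false (by simp [mk_lo hK]; rfl) (Exec.push _ _)).cast ?_ le_rfl
            simp [mk_lo hK, update_mk_lo hK, update_mk_hi]
        · simp
      | false =>
        refine (Exec.branch_false (by simp [mk_lo hK]; rfl) (hp.seq (T' := 2)
          (s'' := mk K (Function.update (fun _ => []) 0 (b :: w))
          [b :: p.1, p.2, List.replicate n false, M, R, [], H, Y, S]) ?_)).cast ?_ (by omega)
        · cases b with
          | true =>
            refine (Exec.branch_true (by simp [mk_lo hK]; rfl) (Exec.push _ _)).cast ?_ le_rfl
            simp [mk_lo hK, update_mk_lo hK, update_mk_hi_zero, mk_hi_zero]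
          | false =>
            refine (Exec.branch_false (by simp [mk_lo hK]; rfl) (Exec.push _ _)).cast ?_ le_rfl
            simp [mk_lo hK, update_mk_lo hK, update_mk_hi_zero, mk_hi_zero]
        · simp
    refine (Exec.loop_cons (by simp [mk_lo hK]) (hb.seq (tail (b :: w) _ _ n))
      (ih (n * 4))).cast ?_ ?_
    · have : ((t :: b :: w).length + 1) / 2 = (w.length + 1) / 2 + 1 := by
        simp only [List.length_cons]; omega
      rw [this, pow_succ', ← mul_assoc]
      simp [parse]
    · have h4 : 1 ≤ 4 ^ w.length := Nat.one_le_pow _ _ (by norm_num)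
      have h5 : n ≤ n * 4 ^ w.length := Nat.le_mul_of_pos_right _ h4
      simp only [List.length_cons, pow_succ]
      ring_nf
      ring_nf at h5
      omega

/-- `z` is a prefix of the stream `r` followed by infinitely many zeros. -/
def hit : Str → Str → Bool
  | [], _ => true
  | b :: z, r => (b == r.headD false) && hit z r.tail

/-- An output as a stream of bits: the bits of `y` from last to first, then a `1`, and then (not
represented) zeros. -/
def stream (y : Str) : Str := y.reverse ++ [true]

/-- The list of next bits after one more sample `y`: if the stream of `y` continues `z`, the next
bit of the stream is added. -/
def record (z y S : Str) : Str :=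
  if hit z (stream y) then ((stream y).drop z.length).headD false :: S else S

/-- Compare the bit `b` with the next bit of the stream, and lower the flag if they differ. -/
def cmpProg (K : ℕ) (b : Bool) : Prog :=
  .branch (K + 4)
    (if b then .pop (K + 4) else .seq (.pop (K + 4)) (.pop (K + 6)))
    (if b then .seq (.pop (K + 4)) (.pop (K + 6)) else .pop (K + 4))
    (if b then .pop (K + 6) else .skip)

lemma exec_cmpProg (O : Str → Bool) (K : ℕ) (b : Bool) (a : Store) (X Z N M R T H Y S : Str) :
    Exec O (cmpProg K b) (mk K a [X, Z, N, M, R, T, H, Y, S])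
      (mk K a [X, Z, N, M, R.tail, T, if b == R.headD false then H else H.tail, Y, S]) 4 := by
  unfold cmpProg
  rcases R with _ | ⟨_ | _, R⟩ <;> cases b
  · exact (Exec.branch_nil (by simp) Exec.skip).cast (by simp) (by omega)
  · exact (Exec.branch_nil (by simp) (Exec.pop _)).cast (by simp [update_mk_hi]) (by omega)
  · exact (Exec.branch_false (by simp; rfl) (Exec.pop _)).cast (by simp [update_mk_hi]) (by omega)
  · exact (Exec.branch_false (by simp; rfl) ((Exec.pop _).seq (Exec.pop _))).cast
      (by simp [update_mk_hi]) (by omega)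
  · exact (Exec.branch_true (by simp; rfl) ((Exec.pop _).seq (Exec.pop _))).cast
      (by simp [update_mk_hi]) (by omega)
  · exact (Exec.branch_true (by simp; rfl) (Exec.pop _)).cast (by simp [update_mk_hi]) (by omega)

lemma exec_drain_cmpProg (O : Str → Bool) (K : ℕ) (a : Store) (X Z N M R T Y S : Str) :
    Exec O (drain (K + 7) (cmpProg K)) (mk K a [X, Z, N, M, R, T, [true], Y, S])
      (mk K a [X, Z, N, M, R.drop Y.length, T, if hit Y R then [true] else [], [], S])
      (8 * Y.length + 1) := by
  have h := Exec.drain (O := O) (i := K + 7) (e := cmpProg K) (τ := 4)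
    (S := fun u (p : Str × Str) => mk K a [X, Z, N, M, p.1, T, p.2, u, S])
    (g := fun b _ p => (p.1.tail, if b == p.1.headD false then p.2 else p.2.tail))
    (fun _ _ => True) (by simp)
    (fun b u p _ => ⟨by simpa [update_mk_hi] using exec_cmpProg .., trivial⟩) Y (R, [true]) trivial
  have hf : ∀ (Y R H : Str), H = [true] ∨ H = [] →
      drainFold (fun b _ (p : Str × Str) =>
        (p.1.tail, if b == p.1.headD false then p.2 else p.2.tail)) Y (R, H) =
      (R.drop Y.length, if hit Y R then H else []) := by
    intro Y
    induction Y with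
    | nil => intro R H _; simp [drainFold, hit]
    | cons b Y ih =>
      intro R H hH
      rw [drainFold, ih]
      · rw [hit]
        rcases hH with rfl | rfl <;> cases (b == R.headD false) <;> simp
      · rcases hH with rfl | rfl <;> cases (b == R.headD false) <;> simp
  rw [hf _ _ _ (Or.inl rfl)] at h
  exact h

/-- Prepare a sample: put `x` on stack `0` and the accuracy parameter on stack `1`. -/
def preProg (K : ℕ) : Prog :=
  .seq (copy K (K + 5) 0 fun b => [b]) (copy (K + 3) (K + 5) 1 fun b => [b])

/-- Evaluate a sample and clean up. -/
def postProg (K : ℕ) : Prog :=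
  .seq (.push (K + 4) true) <| .seq (xfer 0 (K + 4) fun b => [b]) <| .seq (clearBelow K) <|
  .seq (copy (K + 1) (K + 5) (K + 7) fun b => [b]) <| .seq (.push (K + 6) true) <|
  .seq (drain (K + 7) (cmpProg K)) <|
  .seq (.branch (K + 6)
    (.branch (K + 4) (.push (K + 8) true) (.push (K + 8) false) (.push (K + 8) false)) .skip .skip)
  (.seq (clear (K + 6)) (clear (K + 4)))

/-- The sampler for the program `A`. -/
def sampler (K : ℕ) (A : Prog) : Prog :=
  .seq (pushWord (K + 2) (List.replicate 8 false)) <| .seq (parseProg K) <|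
  .seq (dropZeros K (K + 6)) <| .seq (copy (K + 2) (K + 5) (K + 3) fun b => [b]) <|
  .seq (.loop (K + 2) (.seq (.pop (K + 2)) (.seq (preProg K) (.seq A (postProg K)))))
  (.branch (K + 8) (.push 0 true) .skip .skip)

lemma exec_preProg (O : Str → Bool) {K : ℕ} (hK : 2 ≤ K) (X Z N M R H Y S : Str) :
    Exec O (preProg K) (mk K (fun _ => []) [X, Z, N, M, R, [], H, Y, S])
      (mk K (input X M) [X, Z, N, M, R, [], H, Y, S]) (16 * X.length + 16 * M.length + 7) := by
  have h0 : 0 < K := by omega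
  have h1 : 1 < K := by omega
  have e1 : Exec O (copy K (K + 5) 0 fun b => [b])
      (mk K (fun _ => []) [X, Z, N, M, R, [], H, Y, S])
      (mk K (Function.update (fun _ => []) 0 X) [X, Z, N, M, R, [], H, Y, S])
      (16 * X.length + 3) :=
    (Exec.copy (by omega) (by omega) (by omega) (n := 1) (by simp) (by simp)).cast
      (by simp [update_mk_lo h0, mk_lo h0, mk_hi_zero]) (by simp [mk_hi_zero])
  have e2 : Exec O (copy (K + 3) (K + 5) 1 fun b => [b])
      (mk K (Function.update (fun _ => []) 0 X) [X, Z, N, M, R, [], H, Y, S])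
      (mk K (input X M) [X, Z, N, M, R, [], H, Y, S])
      (16 * M.length + 3) := by
    refine (Exec.copy (by omega) (by omega) (by omega) (n := 1) (by simp) (by simp)).cast
      ?_ (by simp)
    rw [update_mk_lo h1]
    simp only [mk_lo h1]
    refine mk_congr (fun i _ => ?_) _
    match i with
    | 0 => simp [input]
    | 1 => simp [input]
    | i + 2 => simp [input]
  exact (e1.seq e2).mono (by omega)

lemma exec_postProg (O : Str → Bool) {K B : ℕ} (hK : 2 ≤ K) (a : Store)
    (ha : ∀ i < K, (a i).length ≤ B) (X Z N M S : Str) :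
    Exec O (postProg K) (mk K a [X, Z, N, M, [], [], [], [], S])
      (mk K (fun _ => []) [X, Z, N, M, [], [], [], [], record Z (a 0) S])
      (K * (2 * B + 2) + 9 * B + 24 * Z.length + 40) := by
  have h0 : 0 < K := by omega
  have e1 : Exec O (.push (K + 4) true) (mk K a [X, Z, N, M, [], [], [], [], S])
      (mk K a [X, Z, N, M, [true], [], [], [], S]) 1 :=
    (Exec.push _ _).cast (by simp [update_mk_hi]) le_rfl
  have e2 : Exec O (xfer 0 (K + 4) fun b => [b]) (mk K a [X, Z, N, M, [true], [], [], [], S])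
      (mk K (Function.update a 0 []) [X, Z, N, M, stream (a 0), [], [], [], S]) (7 * B + 1) :=
    (Exec.move (by omega)).cast (by simp [update_mk_hi, update_mk_lo h0, mk_lo h0, stream])
      (by rw [mk_lo h0]; have := ha 0 h0; omega)
  have e3 : Exec O (clearBelow K)
      (mk K (Function.update a 0 []) [X, Z, N, M, stream (a 0), [], [], [], S])
      (mk K (fun _ => []) [X, Z, N, M, stream (a 0), [], [], [], S]) (K * (2 * B + 2) + 1) := by
    refine Exec.clearBelow fun i hi => ?_
    by_cases h : i = 0
    · simp [h]
    · simpa [h] using ha i hi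
  have e4 : Exec O (copy (K + 1) (K + 5) (K + 7) fun b => [b])
      (mk K (fun _ => []) [X, Z, N, M, stream (a 0), [], [], [], S])
      (mk K (fun _ => []) [X, Z, N, M, stream (a 0), [], [], Z, S]) (16 * Z.length + 3) :=
    (Exec.copy (by omega) (by omega) (by omega) (n := 1) (by simp) (by simp)).cast
      (by simp [update_mk_hi]) (by simp)
  have e5 : Exec O (.push (K + 6) true)
      (mk K (fun _ => []) [X, Z, N, M, stream (a 0), [], [], Z, S])
      (mk K (fun _ => []) [X, Z, N, M, stream (a 0), [], [true], Z, S]) 1 :=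
    (Exec.push _ _).cast (by simp [update_mk_hi]) le_rfl
  have e6 := exec_drain_cmpProg O K (fun _ => []) X Z N M (stream (a 0)) [] Z S
  have e7 : Exec O (.branch (K + 6)
      (.branch (K + 4) (.push (K + 8) true) (.push (K + 8) false) (.push (K + 8) false))
        .skip .skip)
      (mk K (fun _ => []) [X, Z, N, M, (stream (a 0)).drop Z.length, [],
        if hit Z (stream (a 0)) then [true] else [], [], S])
      (mk K (fun _ => []) [X, Z, N, M, (stream (a 0)).drop Z.length, [],
        if hit Z (stream (a 0)) then [true] else [], [], record Z (a 0) S]) 3 := by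
    unfold record
    cases hit Z (stream (a 0)) with
    | false => exact (Exec.branch_nil (by simp) Exec.skip).cast (by simp) (by omega)
    | true =>
      refine Exec.branch_true (by simp; rfl) ?_
      rcases (stream (a 0)).drop Z.length with _ | ⟨_ | _, u⟩
      · exact (Exec.branch_nil (by simp) (Exec.push _ _)).cast (by simp [update_mk_hi]) le_rfl
      · exact (Exec.branch_false (by simp; rfl) (Exec.push _ _)).cast
          (by simp [update_mk_hi]) le_rfl
      · exact (Exec.branch_true (by simp; rfl) (Exec.push _ _)).cast
          (by simp [update_mk_hi]) le_rfl
  have e8 : Exec O (clear (K + 6))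
      (mk K (fun _ => []) [X, Z, N, M, (stream (a 0)).drop Z.length, [],
        if hit Z (stream (a 0)) then [true] else [], [], record Z (a 0) S])
      (mk K (fun _ => []) [X, Z, N, M, (stream (a 0)).drop Z.length, [],
        [], [], record Z (a 0) S]) 3 :=
    (Exec.clear _).cast (by simp [update_mk_hi]) (by simp; split <;> simp)
  have e9 : Exec O (clear (K + 4))
      (mk K (fun _ => []) [X, Z, N, M, (stream (a 0)).drop Z.length, [],
        [], [], record Z (a 0) S])
      (mk K (fun _ => []) [X, Z, N, M, [], [], [], [], record Z (a 0) S]) (2 * B + 3) :=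
    (Exec.clear _).cast (by simp [update_mk_hi])
      (by have := ha 0 h0; simp [stream]; omega)
  exact (e1.seq (e2.seq (e3.seq (e4.seq (e5.seq (e6.seq (e7.seq (e8.seq e9)))))))).mono
    (by omega)

/-! ### Acceptance probability of the sampler -/

/-- The probability that the stream of the output of `A` on `(x, 0^m)`, computed with `T` coins,
continues `z`. -/
noncomputable def hitProb (A : Prog) (x : Str) (m T : ℕ) (z : Str) : ℝ :=
  ev noOracle (fun s => if hit z (stream (s 0)) then 1 else 0) T
    ([A], input x (List.replicate m false))

lemma hitProb_nonneg (A : Prog) (x : Str) (m T : ℕ) (z : Str) : 0 ≤ hitProb A x m T z := by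
  have h := ev_mono noOracle (f := fun _ => 0)
    (g := fun s => if hit z (stream (s 0)) then 1 else 0) (fun s => by split <;> norm_num) T
    ([A], input x (List.replicate m false))
  rwa [ev_const] at h

lemma hitProb_le_one (A : Prog) (x : Str) (m T : ℕ) (z : Str) : hitProb A x m T z ≤ 1 := by
  have h := ev_mono noOracle (f := fun s => if hit z (stream (s 0)) then 1 else 0)
    (g := fun _ => 1) (fun s => by split <;> norm_num) T
    ([A], input x (List.replicate m false))
  rwa [ev_const] at h

lemma hitProb_nil (A : Prog) (x : Str) (m T : ℕ) : hitProb A x m T [] = 1 := by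
  simp [hitProb, hit, ev_const]

lemma hit_append_singleton (z r : Str) (b : Bool) :
    hit (z ++ [b]) r = (hit z r && b == (r.drop z.length).headD false) := by
  induction z generalizing r with
  | nil => simp [hit]
  | cons c z ih =>
    simp only [List.cons_append, hit, ih, List.length_cons, Bool.and_assoc]
    rw [show r.tail.drop z.length = r.drop (z.length + 1) by simp]

/-- The zeros after the end of a stream ensure that it always has a next bit. -/
lemma hitProb_split (A : Prog) (x : Str) (m T : ℕ) (z : Str) :
    hitProb A x m T z = hitProb A x m T (z ++ [false]) + hitProb A x m T (z ++ [true]) := by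
  have h := ev_affine noOracle (fun s => if hit (z ++ [false]) (stream (s 0)) then 1 else 0)
    (fun s => if hit (z ++ [true]) (stream (s 0)) then 1 else 0) 0 1 1 T
    ([A], input x (List.replicate m false))
  rw [hitProb, hitProb, hitProb]
  rw [zero_add, one_mul, one_mul] at h
  rw [← h]
  congr 1
  funext s
  simp only [hit_append_singleton]
  cases hit z (stream (s 0)) <;> cases ((stream (s 0)).drop z.length).headD false <;> simp

/-- Whether the top of the stack is a one. -/
def topVal (S : Str) : ℝ := if S.head? = some true then 1 else 0

/-- The indicator of acceptance. -/
def accInd (s : Store) : ℝ := if s 0 = [true] then 1 else 0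

/-- A bound for the time of one iteration of the sampler. -/
def iterTime (K n m T : ℕ) : ℕ :=
  16 * n + 16 * m + T + (K * (2 * (n + m + T) + 2) + 9 * (n + m + T) + 24 * n) + 60

lemma Val.seq {O : Str → Bool} {f : Store → ℝ} {T : ℕ} {c d : Prog} {k : List Prog} {s : Store}
    {v : ℝ} (h : Val O f T (c :: d :: k, s) v) : Val O f (1 + T) (.seq c d :: k, s) v :=
  Val.of_steps (t := 1) (fun l hl => by
    obtain ⟨b, rfl⟩ := List.length_eq_one_iff.1 hl
    rfl) h

/-- The loop of the sampler: after `n` more samples the latest recorded bit is the bit recorded now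
if none of the samples continues `z`, and otherwise it comes from the last one that does. -/
lemma val_sampler_loop {K : ℕ} (hK : 2 ≤ K) {A : Prog} (hA : A.Below K) {x : Str} {m T : ℕ}
    (hT : HaltsRand A (input x (List.replicate m false)) T) (z : Str) {L : ℕ} (hx : x.length ≤ L)
    (hz : z.length ≤ L) (n : ℕ) (S : Str) :
    Val noOracle accInd (n * iterTime K L m T + 4)
      ([.loop (K + 2) (.seq (.pop (K + 2)) (.seq (preProg K) (.seq A (postProg K)))),
        .branch (K + 8) (.push 0 true) .skip .skip],
        mk K (fun _ => []) [x, z, List.replicate n false, List.replicate m false,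
          [], [], [], [], S])
      ((1 - hitProb A x m T z) ^ n * topVal S +
        hitProb A x m T (z ++ [true]) * ∑ i ∈ Finset.range n, (1 - hitProb A x m T z) ^ i) := by
  have h0 : 0 < K := by omega
  induction n generalizing S with
  | zero =>
    simp only [pow_zero, one_mul, Finset.range_zero, Finset.sum_empty, mul_zero, add_zero, zero_mul]
    have e1 := Exec.loop_nil (O := noOracle) (i := K + 2)
      (c := .seq (.pop (K + 2)) (.seq (preProg K) (.seq A (postProg K))))
      (s := mk K (fun _ => []) [x, z, [], List.replicate m false, [], [], [], [], S]) (by simp)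
    have e2 : Exec noOracle (.branch (K + 8) (.push 0 true) .skip .skip)
        (mk K (fun _ => []) [x, z, [], List.replicate m false, [], [], [], [], S])
        (mk K (if S.head? = some true then Function.update (fun _ => []) 0 [true] else fun _ => [])
          [x, z, [], List.replicate m false, [], [], [], [], S]) 2 := by
      rcases S with _ | ⟨_ | _, S⟩
      · exact (Exec.branch_nil (by simp) Exec.skip).cast (by simp) le_rfl
      · exact (Exec.branch_false (by simp; rfl) Exec.skip).cast (by simp) le_rfl
      · exact (Exec.branch_true (by simp; rfl) (Exec.push _ _)).cast
          (by simp [update_mk_lo h0, mk_lo h0]) le_rfl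
    have h := Val.exec (f := accInd) e1 (Val.exec e2 (Val.halted (T := 0) _))
    have hv : accInd (mk K (if S.head? = some true then Function.update (fun _ => []) 0 [true]
        else fun _ => []) [x, z, [], List.replicate m false, [], [], [], [], S]) = topVal S := by
      unfold accInd topVal
      rw [mk_lo h0]
      split_ifs <;> simp_all
    rw [hv] at h
    exact h.mono (by omega)
  | succ n ih =>
    set q := hitProb A x m T z with hq
    set q1 := hitProb A x m T (z ++ [true]) with hq1
    set loopP : Prog := .loop (K + 2)
      (.seq (.pop (K + 2)) (.seq (preProg K) (.seq A (postProg K)))) with hloop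
    set tailP : Prog := .branch (K + 8) (.push 0 true) .skip .skip with htail
    set W : Str → ℝ := fun S => (1 - q) ^ n * topVal S + q1 * ∑ i ∈ Finset.range n, (1 - q) ^ i
      with hW
    have e1 : Exec noOracle (.pop (K + 2))
        (mk K (fun _ => []) [x, z, List.replicate (n + 1) false, List.replicate m false,
          [], [], [], [], S])
        (mk K (fun _ => []) [x, z, List.replicate n false, List.replicate m false,
          [], [], [], [], S]) 1 :=
      (Exec.pop _).cast (by simp [update_mk_hi, List.replicate_succ]) le_rfl
    have e2 : Exec noOracle (preProg K)
        (mk K (fun _ => []) [x, z, List.replicate n false, List.replicate m false,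
          [], [], [], [], S])
        (mk K (input x (List.replicate m false)) [x, z, List.replicate n false,
          List.replicate m false, [], [], [], [], S]) (16 * L + 16 * m + 7) :=
      (exec_preProg noOracle hK ..).mono (by simp; omega)
    have hA' : ∀ c ∈ [A], c.Below K := by simpa using hA
    have hT' : ∀ r : List Bool, r.length = T →
        (run noOracle r ([A], input x (List.replicate m false))).1 = [] := by
      intro r hr
      have := hT (fun i => r.get (i.cast hr.symm))
      rw [runRand] at this
      have e : List.ofFn (fun i : Fin T => r.get (i.cast hr.symm)) = r := by
        subst hr; simp
      rw [e] at this
      exact this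
    have h3 := Val.append (O := noOracle) (f := accInd) (l := [A])
      (k := [postProg K, loopP, tailP])
      (s := mk K (input x (List.replicate m false)) [x, z, List.replicate n false,
          List.replicate m false, [], [], [], [], S])
      (g := fun s => W (record z (s 0) S)) (T := T)
      (T' := (K * (2 * (L + m + T) + 2) + 9 * (L + m + T) + 24 * L + 40) +
        (n * iterTime K L m T + 4))
      (fun r hr => by rw [run_mk _ _ hA']; exact hT' r hr)
      (fun r hr => by
        rw [run_mk _ _ hA']
        simp only [mk_lo h0]
        refine Val.exec ((exec_postProg noOracle (B := L + m + T) hK _ ?_ ..).mono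
          (by omega)) (ih _)
        intro i _
        refine (length_run_le _ _ _ _).trans ?_
        rw [hr]
        match i with
        | 0 => simp only [input]; omega
        | 1 => simp only [input, List.length_replicate]; omega
        | i + 2 => simp only [input, List.length_nil]; omega)
    -- A sample that continues `z` replaces the latest bit; any other one leaves it alone.
    have hval : ev noOracle (fun s => W (record z (s 0) S)) T
        ([A], mk K (input x (List.replicate m false)) [x, z, List.replicate n false,
          List.replicate m false, [], [], [], [], S]) =
        (1 - q) ^ (n + 1) * topVal S + q1 * ∑ i ∈ Finset.range (n + 1), (1 - q) ^ i := by
      rw [ev_mk _ _ _ hA']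
      simp only [mk_lo h0]
      have := ev_affine noOracle (fun s => if hit (z ++ [true]) (stream (s 0)) then 1 else 0)
        (fun s => if hit z (stream (s 0)) then 1 else 0)
        ((1 - q) ^ n * topVal S + q1 * ∑ i ∈ Finset.range n, (1 - q) ^ i)
        ((1 - q) ^ n) (-((1 - q) ^ n * topVal S)) T
        ([A], input x (List.replicate m false))
      change _ = _ + _ * q1 + _ * q at this
      rw [Finset.sum_range_succ, pow_succ]
      refine Eq.trans ?_ (this.trans (by ring))
      congr 1
      funext s
      simp only [hW, record, hit_append_singleton]
      cases hit z (stream (s 0)) <;>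
        cases ((stream (s 0)).drop z.length).headD false <;> simp [topVal]
      ring
    rw [hval] at h3
    have h4 := Val.seq (Val.exec e1 (Val.seq (Val.exec e2 (Val.seq h3))))
    have h5 := Val.of_steps (t := 1) (κ := ([loopP, tailP], mk K (fun _ => [])
        [x, z, List.replicate (n + 1) false, List.replicate m false, [], [], [], [], S]))
      (fun l hl => by
        obtain ⟨b, rfl⟩ := List.length_eq_one_iff.1 hl
        simp only [run_cons, run_nil, step, hloop, mk_hi]
        rfl) h4
    refine h5.mono ?_
    rw [Nat.succ_mul n]
    unfold iterTime
    omega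

lemma length_parse_le (w : Str) (p : Str × Str) :
    (parse w p).1.length + (parse w p).2.length ≤ w.length + p.1.length + p.2.length := by
  induction w, p using parse.induct with
  | case1 p => simp [parse]
  | case2 b p => simp only [parse]; omega
  | case3 t b w p ih =>
    rw [parse]
    refine ih.trans ?_
    cases t <;> simp <;> omega

lemma length_decode_le (u : Str) : (decode u).length ≤ u.length := by
  induction u with
  | nil => simp [decode]
  | cons b u ih => cases b <;> simp [decode]; omega

/-- The input of the sampled program that is described by the instance `w`. -/
def instX (w : Str) : Str := decode (parse w ([], [])).1

/-- The prefix described by the instance `w`. -/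
def instZ (w : Str) : Str := (parse w ([], [])).2

/-- The number of samples taken, which is also the accuracy parameter of the sampled program, for
instances of length `n`.  It is at least `8 / q` for every probability `q ≥ 4 ^ (-(n / 2))`, which
covers all prefixes met in the search. -/
def numSamples (n : ℕ) : ℕ := 8 * 4 ^ ((n + 1) / 2)

/-- A bound for the running time of the sampler on instances of length `n`. -/
def samplerTime (K : ℕ) (p : Polynomial ℕ) (n : ℕ) : ℕ :=
  480 * 4 ^ n + 40 * n + 16 * numSamples n +
    numSamples n * iterTime K n (numSamples n) (p.eval (n + numSamples n)) + 100

lemma eval_mono (p : Polynomial ℕ) {a b : ℕ} (h : a ≤ b) : p.eval a ≤ p.eval b := by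
  rw [Polynomial.eval_eq_sum_range, Polynomial.eval_eq_sum_range]
  exact Finset.sum_le_sum fun i _ => Nat.mul_le_mul_left _ (Nat.pow_le_pow_left h i)

/-- The sampler halts in exponential time, with this acceptance probability. -/
lemma val_sampler {K : ℕ} (hK : 2 ≤ K) {A : Prog} (hA : A.Below K) {p : Polynomial ℕ}
    (hp : ∀ (x : Str) (m : ℕ),
      HaltsRand A (input x (List.replicate m false)) (p.eval (x.length + m))) (w : Str) :
    Val noOracle accInd (samplerTime K p w.length) ([sampler K A], input w [])
      (hitProb A (instX w) (numSamples w.length)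
          (p.eval ((instX w).length + numSamples w.length)) (instZ w ++ [true]) *
        ∑ i ∈ Finset.range (numSamples w.length),
          (1 - hitProb A (instX w) (numSamples w.length)
            (p.eval ((instX w).length + numSamples w.length)) (instZ w)) ^ i) := by
  have h0 : 0 < K := by omega
  set N := numSamples w.length with hN
  have hlen := length_parse_le w ([], [])
  simp only [List.length_nil, add_zero] at hlen
  have hx : (instX w).length ≤ w.length := (length_decode_le _).trans (by omega)
  have hz : (instZ w).length ≤ w.length := by unfold instZ; omega
  have e0 : input w [] = mk K (Function.update (fun _ => []) 0 w)
      [[], [], [], [], [], [], [], [], []] := by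
    rw [input_nil]
    funext i
    unfold mk
    split_ifs with h
    · rfl
    · rw [Function.update_of_ne (by omega)]
      rcases lt_or_ge (i - K) 9 with h9 | h9
      · interval_cases i - K <;> rfl
      · rw [List.getD_eq_default _ _ (by simpa using h9)]
  have e1 : Exec noOracle (pushWord (K + 2) (List.replicate 8 false)) (input w [])
      (mk K (Function.update (fun _ => []) 0 w)
        [[], [], List.replicate 8 false, [], [], [], [], [], []]) 17 := by
    rw [e0]
    exact (Exec.pushWord _ _).cast (by simp [update_mk_hi]) (by simp)
  have e2 := exec_parseProg noOracle h0 w [] [] [] [] [] [] [] 8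
  have e3 : Exec noOracle (dropZeros K (K + 6)) (mk K (fun _ => [])
      [(parse w ([], [])).1, (parse w ([], [])).2, List.replicate N false, [], [], [], [], [], []])
      (mk K (fun _ => []) [instX w, instZ w, List.replicate N false, [], [], [], [], [], []])
      (4 * w.length + 8) :=
    (Exec.dropZeros (by omega) (by simp)).cast
      (by simp [update_mk_hi_zero, mk_hi_zero, instX, instZ]) (by simp [mk_hi_zero]; omega)
  have e4 : Exec noOracle (copy (K + 2) (K + 5) (K + 3) fun b => [b]) (mk K (fun _ => [])
      [instX w, instZ w, List.replicate N false, [], [], [], [], [], []])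
      (mk K (fun _ => []) [instX w, instZ w, List.replicate N false, List.replicate N false,
        [], [], [], [], []]) (16 * N + 3) :=
    (Exec.copy (by omega) (by omega) (by omega) (n := 1) (by simp) (by simp)).cast
      (by simp [update_mk_hi]) (by simp)
  have e5 := val_sampler_loop hK hA (hp (instX w) N) (instZ w) hx hz N []
  have h := Val.seq (Val.exec e1 (Val.seq (Val.exec e2 (Val.seq (Val.exec e3
    (Val.seq (Val.exec e4 (Val.seq e5))))))))
  simp only [topVal, List.head?_nil, reduceCtorEq, if_false, mul_zero, zero_add] at h
  refine h.mono ?_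
  have h1 : iterTime K w.length N (p.eval ((instX w).length + N)) ≤
      iterTime K w.length N (p.eval (w.length + N)) := by
    have := eval_mono p (Nat.add_le_add_right hx N)
    unfold iterTime
    gcongr
  have h2 := Nat.mul_le_mul_left N h1
  unfold samplerTime
  rw [← hN]
  omega

/-! ### The promise problem of the sampler -/

/-- `f n ≤ 2^P(n)` for some polynomial `P`. -/
def ExpBounded (f : ℕ → ℕ) : Prop := ∃ P : Polynomial ℕ, ∀ n, f n ≤ 2 ^ P.eval n

namespace ExpBounded

variable {f g : ℕ → ℕ}

lemma const (c : ℕ) : ExpBounded fun _ => c :=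
  ⟨Polynomial.C c, fun n => by simpa using Nat.lt_two_pow_self.le⟩

lemma id : ExpBounded fun n => n :=
  ⟨Polynomial.X, fun n => by simpa using Nat.lt_two_pow_self.le⟩

lemma add (hf : ExpBounded f) (hg : ExpBounded g) : ExpBounded fun n => f n + g n := by
  obtain ⟨P, hP⟩ := hf
  obtain ⟨Q, hQ⟩ := hg
  refine ⟨P + Q + 1, fun n => ?_⟩
  have h1 : 2 ^ P.eval n ≤ 2 ^ (P.eval n + Q.eval n) :=
    Nat.pow_le_pow_right (by norm_num) (by omega)
  have h2 : 2 ^ Q.eval n ≤ 2 ^ (P.eval n + Q.eval n) :=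
    Nat.pow_le_pow_right (by norm_num) (by omega)
  have h3 := hP n
  have h4 := hQ n
  simp only [Polynomial.eval_add, Polynomial.eval_one, pow_succ]
  omega

lemma mul (hf : ExpBounded f) (hg : ExpBounded g) : ExpBounded fun n => f n * g n := by
  obtain ⟨P, hP⟩ := hf
  obtain ⟨Q, hQ⟩ := hg
  refine ⟨P + Q, fun n => ?_⟩
  rw [Polynomial.eval_add, pow_add]
  exact Nat.mul_le_mul (hP n) (hQ n)

lemma eval (hf : ExpBounded f) (p : Polynomial ℕ) : ExpBounded fun n => p.eval (f n) := by
  induction p using Polynomial.induction_on' with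
  | add p q hp hq => simpa using hp.add hq
  | monomial k a =>
    simp only [Polynomial.eval_monomial]
    refine (const a).mul ?_
    induction k with
    | zero => simpa using const 1
    | succ k ih => simpa only [pow_succ] using ih.mul hf

lemma mono (hf : ExpBounded f) (h : ∀ n, g n ≤ f n) : ExpBounded g := by
  obtain ⟨P, hP⟩ := hf
  exact ⟨P, fun n => (h n).trans (hP n)⟩

end ExpBounded

lemma expBounded_samplerTime (K : ℕ) (p : Polynomial ℕ) : ExpBounded (samplerTime K p) := by
  have hc := ExpBounded.const
  have hid := ExpBounded.id
  have h4 : ExpBounded fun n => 4 ^ n :=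
    ⟨2 * Polynomial.X, fun n => by
      rw [Polynomial.eval_mul, Polynomial.eval_X, pow_mul]
      norm_num⟩
  have hN : ExpBounded numSamples := ((hc 32).mul h4).mono fun n => by
    have : 4 ^ ((n + 1) / 2) ≤ 4 ^ (n + 1) := Nat.pow_le_pow_right (by norm_num) (by omega)
    unfold numSamples
    rw [pow_succ] at this
    omega
  have hT := (hid.add hN).eval p
  have hS := (hid.add hN).add hT
  have hI : ExpBounded fun n => iterTime K n (numSamples n) (p.eval (n + numSamples n)) :=
    (((((hc 16).mul hid).add ((hc 16).mul hN)).add hT).add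
      ((((hc K).mul (((hc 2).mul hS).add (hc 2))).add ((hc 9).mul hS)).add
        ((hc 24).mul hid))).add (hc 60)
  exact ((((((hc 480).mul h4).add ((hc 40).mul hid)).add ((hc 16).mul hN)).add
    (hN.mul hI)).add (hc 100))

lemma queryFree_sampler (K : ℕ) {A : Prog} (hA : A.QueryFree) : (sampler K A).QueryFree := by
  have hc : ∀ b, (cmpProg K b).QueryFree := by
    intro b; cases b <;> simp [cmpProg, Prog.QueryFree]
  simp [sampler, parseProg, quadProg, preProg, postProg, Prog.QueryFree, hA, hc]

/-- The promise problem of telling whether a randomized program accepts with probability at least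
`2/3` or at most `1/3`. -/
noncomputable def acceptance (acc : Str → ℝ) : PromiseProblem where
  yes := {w | 2 / 3 ≤ acc w}
  no := {w | acc w ≤ 1 / 3}
  disj := Set.disjoint_left.2 fun w (h : 2 / 3 ≤ acc w) (h' : acc w ≤ 1 / 3) => by linarith

/-- The acceptance probability of the sampler on the instance `w`. -/
noncomputable def samplerAcc (A : Prog) (p : Polynomial ℕ) (w : Str) : ℝ :=
  hitProb A (instX w) (numSamples w.length)
      (p.eval ((instX w).length + numSamples w.length)) (instZ w ++ [true]) *
    ∑ i ∈ Finset.range (numSamples w.length),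
      (1 - hitProb A (instX w) (numSamples w.length)
        (p.eval ((instX w).length + numSamples w.length)) (instZ w)) ^ i

lemma acceptance_mem_promiseBPEXP {A : Prog} (hA : A.QueryFree) {p : Polynomial ℕ}
    (hp : ∀ (x : Str) (m : ℕ),
      HaltsRand A (input x (List.replicate m false)) (p.eval (x.length + m))) :
    acceptance (samplerAcc A p) ∈ PromiseBPEXP := by
  obtain ⟨K, hK, hAK⟩ := A.exists_below
  obtain ⟨P, hP⟩ := expBounded_samplerTime K p
  have hv : ∀ w, Val noOracle accInd (2 ^ P.eval w.length) ([sampler K A], input w [])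
      (samplerAcc A p w) := fun w => (val_sampler hK hAK hp w).mono (hP _)
  have hprob : ∀ w, prob (sampler K A) (input w []) (2 ^ P.eval w.length) {[true]} =
      samplerAcc A p w := fun w => by
    rw [prob_eq_ev, ← (hv w).2]
    congr 1
    funext s
    simp [accInd]
  refine ⟨sampler K A, P, queryFree_sampler K hA, fun w r => ?_, fun w hw => ?_, fun w hw => ?_⟩
  · exact (hv w).1 (List.ofFn r) (by simp)
  · rw [hprob]; exact hw
  · rw [hprob]; exact hw

/-! ### The searcher -/

/-! The searcher uses the stacks `K, …, K + 6`: the reversed input `x`, a counter, the bits found so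
far, the query, a work stack, the advice, and another work stack. -/

/-- The query about the bits `P` found so far (the latest first) for the input `x`; the word `u`
only pads the query. -/
def queryWord (u x P : Str) : Str :=
  P.flatMap (fun b => [true, b]) ++ (x.reverse.flatMap (fun b => [false, b]) ++
    ([false, true] ++ u.flatMap fun _ => [false, false]))

/-- The bits found with the oracle `O`, the latest first, when `u` is left on the counter and the
bits `P` have been found. -/
def search (O : Str → Bool) (x u P : Str) : Str :=
  drainFold (fun _ u P => O (queryWord u x P) :: P) u P

/-- Multiply the counter by `|x| + 1`. -/
def multProg (K : ℕ) : Prog :=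
  .seq (xfer (K + 1) (K + 6) fun b => [b])
    (drain (K + 6) fun _ => .seq (.push (K + 1) false) (copy K (K + 4) (K + 1) fun _ => [false]))

/-- Multiply the counter by `(|x| + 1)^d`. -/
def powProg (K : ℕ) : ℕ → Prog
  | 0 => .skip
  | d + 1 => .seq (powProg K d) (multProg K)

/-- Write the query, ask it, which is done by the program `ask`, and erase it. -/
def roundProg (K : ℕ) (ask : Prog) : Prog :=
  .seq (copy (K + 1) (K + 4) (K + 3) fun _ => [false, false]) <|
  .seq (pushWord (K + 3) [false, true]) <|
  .seq (copy K (K + 4) (K + 3) fun b => [false, b]) <|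
  .seq (copy (K + 2) (K + 4) (K + 3) fun b => [true, b]) <| .seq ask (clear (K + 3))

/-- The searcher: find `a (|x| + 1)^d` bits, and decode the output from them. -/
def searchProg (K a d : ℕ) (ask : Prog) : Prog :=
  .seq (xfer 0 K fun b => [b]) <| .seq (xfer 1 (K + 4) fun b => [b]) <|
  .seq (xfer (K + 4) (K + 5) fun b => [b]) <|
  .seq (pushWord (K + 1) (List.replicate a false)) <| .seq (powProg K d) <|
  .seq (drain (K + 1) fun _ => roundProg K ask) <| .seq (dropZeros (K + 2) (K + 4)) <|
  .seq (xfer (K + 2) (K + 4) fun b => [b]) (xfer (K + 4) 0 fun b => [b])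

lemma length_queryWord (u x P : Str) :
    (queryWord u x P).length = 2 * (u.length + 1 + P.length + x.length) := by
  simp [queryWord, List.length_flatMap]
  ring

lemma length_search (O : Str → Bool) (x u P : Str) :
    (search O x u P).length = u.length + P.length := by
  induction u generalizing P with
  | nil => simp [search, drainFold]
  | cons b u ih =>
    have := ih (O (queryWord u x P) :: P)
    rw [search] at this ⊢
    rw [drainFold, this]
    simp only [List.length_cons]
    omega

lemma exec_multProg (O : Str → Bool) (K n c : ℕ) (a : Store) (X P W V : Str) (hX : X.length = n) :
    Exec O (multProg K) (mk K a [X, List.replicate c false, P, W, [], V, []])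
      (mk K a [X, List.replicate (c * (n + 1)) false, P, W, [], V, []])
      ((16 * n + 17) * c + 3) := by
  have e1 : Exec O (xfer (K + 1) (K + 6) fun b => [b])
      (mk K a [X, List.replicate c false, P, W, [], V, []])
      (mk K a [X, [], P, W, [], V, List.replicate c false]) (7 * c + 1) :=
    (Exec.move (by omega)).cast (by simp [update_mk_hi]) (by simp)
  have e2 := Exec.drain (O := O) (i := K + 6)
    (e := fun _ => .seq (.push (K + 1) false) (copy K (K + 4) (K + 1) fun _ => [false]))
    (τ := 16 * n + 5) (S := fun u (C : Str) => mk K a [X, C, P, W, [], V, u])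
    (g := fun _ _ C => List.replicate (n + 1) false ++ C) (fun _ _ => True) (by simp)
    (fun b u C _ => by
      refine ⟨?_, trivial⟩
      have h1 : Exec O (.push (K + 1) false)
          (Function.update (mk K a [X, C, P, W, [], V, b :: u]) (K + 6) u)
          (mk K a [X, false :: C, P, W, [], V, u]) 1 :=
        (Exec.push _ _).cast (by simp [update_mk_hi]) le_rfl
      have h2 : Exec O (copy K (K + 4) (K + 1) fun _ => [false])
          (mk K a [X, false :: C, P, W, [], V, u])
          (mk K a [X, List.replicate (n + 1) false ++ C, P, W, [], V, u]) (16 * n + 3) := by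
        refine (Exec.copy (by omega) (by omega) (by omega) (n := 1) (by simp) (by simp)).cast ?_
          (by simp [mk_hi_zero, hX])
        have hr : ∀ u : Str, u.flatMap (fun _ => [false]) = List.replicate u.length false := by
          intro u
          induction u with
          | nil => rfl
          | cons b u ih => simp [List.replicate_succ, ih]
        have := hr X
        rw [hX] at this
        simp [update_mk_hi, mk_hi_zero, this, List.replicate_succ', -List.append_eq]
      exact (h1.seq h2).mono (by omega)) (List.replicate c false) [] trivial
  have hf : ∀ (c : ℕ) (C : Str), drainFold (fun _ _ C => List.replicate (n + 1) false ++ C)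
      (List.replicate c false) C = List.replicate (c * (n + 1)) false ++ C := by
    intro c
    induction c with
    | zero => intro C; simp [drainFold]
    | succ c ih =>
      intro C
      rw [List.replicate_succ (n := c), drainFold, ih, Nat.succ_mul c,
        ← List.append_assoc, ← List.replicate_add]
  rw [hf, List.append_nil, List.length_replicate] at e2
  refine (e1.seq e2).mono ?_
  ring_nf
  omega

lemma exec_powProg (O : Str → Bool) (K n c d : ℕ) (a : Store) (X P W V : Str)
    (hX : X.length = n) :
    Exec O (powProg K d) (mk K a [X, List.replicate c false, P, W, [], V, []])
      (mk K a [X, List.replicate (c * (n + 1) ^ d) false, P, W, [], V, []])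
      (d * ((16 * n + 17) * (c * (n + 1) ^ d) + 4) + 1) := by
  induction d with
  | zero => exact Exec.skip.cast (by simp) (by simp)
  | succ d ih =>
    refine (ih.seq (exec_multProg O K n _ a X P W V hX)).cast ?_ ?_
    · rw [pow_succ, mul_assoc]
    · have h : c * (n + 1) ^ d ≤ c * (n + 1) ^ (d + 1) :=
        Nat.mul_le_mul_left _ (Nat.pow_le_pow_right (by omega) (by omega))
      have h' := Nat.mul_le_mul_left (16 * n + 17) h
      have h'' := Nat.mul_le_mul_left d (Nat.add_le_add_right h' 4)
      rw [Nat.succ_mul d]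
      omega

/-- `ask` answers queries of length `ℓ` according to `O`, in time `τ`, when the advice is `V`. -/
def Answers (O' : Str → Bool) (K : ℕ) (ask : Prog) (V : Str) (O : Str → Bool) (ℓ τ : ℕ) : Prop :=
  ∀ X C P W : Str, W.length = ℓ →
    Exec O' ask (mk K (fun _ => []) [X, C, P, W, [], V, []])
      (mk K (fun _ => []) [X, C, O W :: P, W, [], V, []]) τ

lemma exec_roundProg {O' O : Str → Bool} {K c : ℕ} {ask : Prog} {V x u P : Str} {τ : ℕ}
    (hask : Answers O' K ask V O (2 * (c + x.length)) τ) (hc : u.length + 1 + P.length = c) :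
    Exec O' (roundProg K ask) (mk K (fun _ => []) [x.reverse, u, P, [], [], V, []])
      (mk K (fun _ => []) [x.reverse, u, O (queryWord u x P) :: P, [], [], V, []])
      (22 * c + 22 * x.length + τ + 20) := by
  have e1 : Exec O' (copy (K + 1) (K + 4) (K + 3) fun _ => [false, false])
      (mk K (fun _ => []) [x.reverse, u, P, [], [], V, []])
      (mk K (fun _ => []) [x.reverse, u, P, u.flatMap fun _ => [false, false], [], V, []])
      (18 * u.length + 3) :=
    (Exec.copy (by omega) (by omega) (by omega) (n := 2) (by simp) (by simp)).cast
      (by simp [update_mk_hi]) (by simp)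
  have e2 : Exec O' (pushWord (K + 3) [false, true])
      (mk K (fun _ => []) [x.reverse, u, P, u.flatMap fun _ => [false, false], [], V, []])
      (mk K (fun _ => []) [x.reverse, u, P,
        [false, true] ++ u.flatMap fun _ => [false, false], [], V, []]) 5 :=
    (Exec.pushWord _ _).cast (by simp [update_mk_hi]) (by simp)
  have e3 : Exec O' (copy K (K + 4) (K + 3) fun b => [false, b])
      (mk K (fun _ => []) [x.reverse, u, P,
        [false, true] ++ u.flatMap fun _ => [false, false], [], V, []])
      (mk K (fun _ => []) [x.reverse, u, P, x.reverse.flatMap (fun b => [false, b]) ++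
        ([false, true] ++ u.flatMap fun _ => [false, false]), [], V, []])
      (18 * x.length + 3) :=
    (Exec.copy (by omega) (by omega) (by omega) (n := 2) (by simp) (by simp)).cast
      (by simp [update_mk_hi, mk_hi_zero]) (by simp [mk_hi_zero])
  have e4 : Exec O' (copy (K + 2) (K + 4) (K + 3) fun b => [true, b])
      (mk K (fun _ => []) [x.reverse, u, P, x.reverse.flatMap (fun b => [false, b]) ++
        ([false, true] ++ u.flatMap fun _ => [false, false]), [], V, []])
      (mk K (fun _ => []) [x.reverse, u, P, queryWord u x P, [], V, []])
      (18 * P.length + 3) :=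
    (Exec.copy (by omega) (by omega) (by omega) (n := 2) (by simp) (by simp)).cast
      (by simp [update_mk_hi, queryWord]) (by simp)
  have hl := length_queryWord u x P
  rw [hc] at hl
  have e5 := hask x.reverse u P (queryWord u x P) hl
  have e6 : Exec O' (clear (K + 3))
      (mk K (fun _ => []) [x.reverse, u, O (queryWord u x P) :: P, queryWord u x P, [], V, []])
      (mk K (fun _ => []) [x.reverse, u, O (queryWord u x P) :: P, [], [], V, []])
      (4 * c + 4 * x.length + 1) :=
    (Exec.clear _).cast (by simp [update_mk_hi]) (by simp [hl]; omega)
  exact (e1.seq (e2.seq (e3.seq (e4.seq (e5.seq e6))))).mono (by omega)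

/-- A bound for the running time of the searcher with inputs of length at most `N`. -/
def searchTime (a d τ N : ℕ) : ℕ :=
  d * ((16 * N + 17) * (a * (N + 1) ^ d) + 4) +
    (22 * (a * (N + 1) ^ d) + 22 * N + τ + 24) * (a * (N + 1) ^ d) + 18 * (a * (N + 1) ^ d) +
    21 * N + 2 * a + 40

/-- The final store of the searcher. -/
lemma exec_searchProg {O' O : Str → Bool} {K a d : ℕ} (hK : 2 ≤ K) {ask : Prog} {V x : Str}
    {τ N : ℕ} (hask : Answers O' K ask V O (2 * (a * (x.length + 1) ^ d + x.length)) τ)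
    (hx : x.length ≤ N) (hV : V.length ≤ N) :
    Exec O' (searchProg K a d ask) (input x V)
      (mk K (Function.update (fun _ => []) 0
        (decode (search O x (List.replicate (a * (x.length + 1) ^ d) false) [])))
        [x.reverse, [], [], [], [], V, []]) (searchTime a d τ N) := by
  have h0 : 0 < K := by omega
  have h1 : 1 < K := by omega
  set c := a * (x.length + 1) ^ d with hc
  have hcN : c ≤ a * (N + 1) ^ d :=
    Nat.mul_le_mul_left _ (Nat.pow_le_pow_left (by omega) _)
  set C := a * (N + 1) ^ d with hC
  set P := search O x (List.replicate c false) [] with hP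
  have hPl : P.length = c := by rw [hP, length_search]; simp
  have e0 : input x V = mk K (input x V) [[], [], [], [], [], [], []] := by
    funext i
    unfold mk
    split_ifs with h
    · rfl
    · obtain ⟨i, rfl⟩ : ∃ j, i = j + 2 := ⟨i - 2, by omega⟩
      rcases lt_or_ge (i + 2 - K) 7 with h7 | h7
      · interval_cases i + 2 - K <;> rfl
      · rw [List.getD_eq_default _ _ (by simpa using h7)]
        rfl
  have e1 : Exec O' (xfer 0 K fun b => [b]) (mk K (input x V) [[], [], [], [], [], [], []])
      (mk K (Function.update (input x V) 0 []) [x.reverse, [], [], [], [], [], []])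
      (7 * N + 1) := by
    refine (Exec.move (by omega)).cast ?_ (by simp [mk_lo h0, input]; omega)
    simp [update_mk_hi_zero, update_mk_lo h0, mk_lo h0, mk_hi_zero, input]
  rw [← e0] at e1
  have e2 : Exec O' (xfer 1 (K + 4) fun b => [b])
      (mk K (Function.update (input x V) 0 []) [x.reverse, [], [], [], [], [], []])
      (mk K (fun _ => []) [x.reverse, [], [], [], V.reverse, [], []]) (7 * N + 1) := by
    refine (Exec.move (by omega)).cast ?_ (by simp [mk_lo h1, input]; omega)
    rw [update_mk_lo h1, update_mk_hi (by simp)]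
    simp only [mk_lo h1, mk_hi]
    have : (V.reverse ++ [] : Str) = V.reverse := by simp
    refine Eq.trans (mk_congr (a' := fun _ => []) (fun i _ => ?_) _) (by simp [input])
    match i with
    | 0 => simp
    | 1 => simp
    | i + 2 => simp [input]
  have e3 : Exec O' (xfer (K + 4) (K + 5) fun b => [b])
      (mk K (fun _ => []) [x.reverse, [], [], [], V.reverse, [], []])
      (mk K (fun _ => []) [x.reverse, [], [], [], [], V, []]) (7 * N + 1) :=
    (Exec.move (by omega)).cast (by simp [update_mk_hi]) (by simp; omega)
  have e4 : Exec O' (pushWord (K + 1) (List.replicate a false))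
      (mk K (fun _ => []) [x.reverse, [], [], [], [], V, []])
      (mk K (fun _ => []) [x.reverse, List.replicate a false, [], [], [], V, []]) (2 * a + 1) :=
    (Exec.pushWord _ _).cast (by simp [update_mk_hi]) (by simp)
  have e5 : Exec O' (powProg K d)
      (mk K (fun _ => []) [x.reverse, List.replicate a false, [], [], [], V, []])
      (mk K (fun _ => []) [x.reverse, List.replicate c false, [], [], [], V, []])
      (d * ((16 * N + 17) * C + 4) + 1) :=
    (exec_powProg O' K x.length a d _ _ _ _ _ (by simp)).mono (by gcongr)
  have e6 : Exec O' (drain (K + 1) fun _ => roundProg K ask)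
      (mk K (fun _ => []) [x.reverse, List.replicate c false, [], [], [], V, []])
      (mk K (fun _ => []) [x.reverse, [], P, [], [], V, []])
      ((22 * C + 22 * N + τ + 24) * C + 1) := by
    have h := Exec.drain (O := O') (i := K + 1) (e := fun _ => roundProg K ask)
      (τ := 22 * c + 22 * x.length + τ + 20)
      (S := fun u (P : Str) => mk K (fun _ => []) [x.reverse, u, P, [], [], V, []])
      (g := fun _ u P => O (queryWord u x P) :: P) (fun u P => u.length + P.length = c)
      (by simp)
      (fun b u P hI => by
        simp only [List.length_cons] at hI
        refine ⟨?_, by simp only [List.length_cons]; omega⟩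
        simpa [update_mk_hi] using exec_roundProg hask hI)
      (List.replicate c false) [] (by simp)
    refine h.mono ?_
    rw [List.length_replicate]
    gcongr ?_ * ?_ + 1
    omega
  have e7 : Exec O' (dropZeros (K + 2) (K + 4))
      (mk K (fun _ => []) [x.reverse, [], P, [], [], V, []])
      (mk K (fun _ => []) [x.reverse, [], decode P, [], [], V, []]) (4 * C + 8) :=
    (Exec.dropZeros (by omega) (by simp)).cast (by simp [update_mk_hi]) (by simp; omega)
  have hd := length_decode_le P
  have e8 : Exec O' (xfer (K + 2) (K + 4) fun b => [b])
      (mk K (fun _ => []) [x.reverse, [], decode P, [], [], V, []])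
      (mk K (fun _ => []) [x.reverse, [], [], [], (decode P).reverse, V, []]) (7 * C + 1) :=
    (Exec.move (by omega)).cast (by simp [update_mk_hi]) (by simp; omega)
  have e9 : Exec O' (xfer (K + 4) 0 fun b => [b])
      (mk K (fun _ => []) [x.reverse, [], [], [], (decode P).reverse, V, []])
      (mk K (Function.update (fun _ => []) 0 (decode P)) [x.reverse, [], [], [], [], V, []])
      (7 * C + 1) :=
    (Exec.move (by omega)).cast (by simp [update_mk_hi, update_mk_lo h0, mk_lo h0])
      (by simp; omega)
  refine (e1.seq (e2.seq (e3.seq (e4.seq (e5.seq (e6.seq (e7.seq (e8.seq e9)))))))).mono ?_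
  unfold searchTime
  rw [← hC]
  omega

lemma tossFree_searchProg (K a d : ℕ) {ask : Prog} (h : ask.TossFree) :
    (searchProg K a d ask).TossFree := by
  have hp : (powProg K d).TossFree := by
    induction d <;> simp_all [powProg, multProg, Prog.TossFree]
  simp [searchProg, roundProg, Prog.TossFree, h, hp]

lemma queryFree_searchProg (K a d : ℕ) {ask : Prog} (h : ask.QueryFree) :
    (searchProg K a d ask).QueryFree := by
  have hp : (powProg K d).QueryFree := by
    induction d <;> simp_all [powProg, multProg, Prog.QueryFree]
  simp [searchProg, roundProg, Prog.QueryFree, h, hp]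

/-- A query instruction answers according to the oracle. -/
lemma answers_query (O : Str → Bool) (K : ℕ) (V : Str) (ℓ : ℕ) :
    Answers O K (.query (K + 3) (K + 2)) V O ℓ 1 := fun X C P W _ =>
  (Exec.query _ _).cast (by simp [update_mk_hi]) le_rfl

/-- Ask the deterministic program `B`, giving it the advice, instead of an oracle. -/
def askProg (K : ℕ) (B : Prog) : Prog :=
  .seq (copy (K + 3) (K + 4) 0 fun b => [b]) <| .seq (copy (K + 5) (K + 4) 1 fun b => [b]) <|
  .seq B <|
  .seq (.branch 0
    (.seq (.pop 0)
      (.branch 0 (.push (K + 2) false) (.push (K + 2) false) (.push (K + 2) true)))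
    (.push (K + 2) false) (.push (K + 2) false))
  (clearBelow K)

lemma answers_askProg (O' : Str → Bool) {K : ℕ} (hK : 2 ≤ K) {B : Prog} (hB : B.Below K)
    (ht : B.TossFree) (hq : B.QueryFree) {p : Polynomial ℕ}
    (hp : ∀ u v : Str, HaltsDet noOracle B (input u v) (p.eval (u.length + v.length)))
    (V : Str) (ℓ : ℕ) :
    Answers O' K (askProg K B) V
      (fun W => outDet noOracle B (input W V) (p.eval (W.length + V.length)) == [true]) ℓ
      (16 * ℓ + 16 * V.length + p.eval (ℓ + V.length) +
        K * (2 * (ℓ + V.length + p.eval (ℓ + V.length)) + 2) + 16) := by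
  intro X C P W hW
  subst hW
  have h0 : 0 < K := by omega
  have h1 : 1 < K := by omega
  set T := p.eval (W.length + V.length) with hT
  have e1 : Exec O' (copy (K + 3) (K + 4) 0 fun b => [b])
      (mk K (fun _ => []) [X, C, P, W, [], V, []])
      (mk K (Function.update (fun _ => []) 0 W) [X, C, P, W, [], V, []])
      (16 * W.length + 3) :=
    (Exec.copy (by omega) (by omega) (by omega) (n := 1) (by simp) (by simp)).cast
      (by simp [update_mk_lo h0, mk_lo h0]) (by simp)
  have e2 : Exec O' (copy (K + 5) (K + 4) 1 fun b => [b])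
      (mk K (Function.update (fun _ => []) 0 W) [X, C, P, W, [], V, []])
      (mk K (input W V) [X, C, P, W, [], V, []]) (16 * V.length + 3) := by
    refine (Exec.copy (by omega) (by omega) (by omega) (n := 1) (by simp) (by simp)).cast
      ?_ (by simp)
    rw [update_mk_lo h1]
    simp only [mk_lo h1]
    refine mk_congr (fun i _ => ?_) _
    match i with
    | 0 => simp [input]
    | 1 => simp [input]
    | i + 2 => simp [input]
  have e3 := Exec.of_haltsDet O' hB ht hq (hp W V) [X, C, P, W, [], V, []]
  rw [← hT] at e3
  set s := (runDet noOracle B (input W V) T).2 with hs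
  change Exec O' _ _ (mk K _ [X, C, (s 0 == [true]) :: P, W, [], V, []]) _
  have hlen : ∀ i < K, (s i).length ≤ W.length + V.length + T := by
    intro i _
    rw [hs, runDet, runDet_eq_run]
    refine (length_run_le _ _ _ _).trans ?_
    rw [List.length_replicate]
    match i with
    | 0 => simp only [input]; omega
    | 1 => simp only [input]; omega
    | i + 2 => simp only [input, List.length_nil]; omega
  obtain ⟨s', hs', e4⟩ : ∃ s' : Store, (∀ i < K, (s' i).length ≤ W.length + V.length + T) ∧
      Exec O' (.branch 0 (.seq (.pop 0)
          (.branch 0 (.push (K + 2) false) (.push (K + 2) false) (.push (K + 2) true)))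
          (.push (K + 2) false) (.push (K + 2) false))
        (mk K s [X, C, P, W, [], V, []])
        (mk K s' [X, C, (s 0 == [true]) :: P, W, [], V, []]) 5 := by
    rcases h : s 0 with _ | ⟨_ | _, u⟩
    · exact ⟨s, hlen, (Exec.branch_nil (by simp [mk_lo h0, h]) (Exec.push _ _)).cast
        (by simp [update_mk_hi]) (by omega)⟩
    · exact ⟨s, hlen, (Exec.branch_false (by rw [mk_lo h0, h]) (Exec.push _ _)).cast
        (by simp [update_mk_hi]) (by omega)⟩
    · refine ⟨Function.update s 0 u, fun i hi => ?_, ?_⟩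
      · by_cases hi0 : i = 0
        · have := hlen 0 h0
          rw [h, List.length_cons] at this
          subst hi0
          simp only [Function.update_self]
          omega
        · simpa [hi0] using hlen i hi
      · refine (Exec.branch_true (by rw [mk_lo h0, h]) ((Exec.pop 0).seq (T' := 2)
          (s'' := mk K (Function.update s 0 u)
            [X, C, ((true :: u : Str) == [true]) :: P, W, [], V, []]) ?_)).mono (by omega)
        rcases u with _ | ⟨_ | _, u⟩
        · exact (Exec.branch_nil (by simp [mk_lo h0, h]) (Exec.push _ _)).cast
            (by simp [update_mk_hi, update_mk_lo h0, mk_lo h0, h]) (by omega)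
        · exact (Exec.branch_false (by simp [mk_lo h0, h]; rfl)
            (Exec.push _ _)).cast
            (by simp [update_mk_hi, update_mk_lo h0, mk_lo h0, h]) (by omega)
        · exact (Exec.branch_true (by simp [mk_lo h0, h]; rfl)
            (Exec.push _ _)).cast
            (by simp [update_mk_hi, update_mk_lo h0, mk_lo h0, h]) (by omega)
  have e5 := Exec.clearBelow (O := O') hs' (l := [X, C, (s 0 == [true]) :: P, W, [], V, []])
  exact (e1.seq (e2.seq (e3.seq (e4.seq e5)))).mono (by omega)

lemma tossFree_askProg (K : ℕ) {B : Prog} (h : B.TossFree) : (askProg K B).TossFree := by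
  simp [askProg, Prog.TossFree, h]

lemma queryFree_askProg (K : ℕ) {B : Prog} (h : B.QueryFree) : (askProg K B).QueryFree := by
  simp [askProg, Prog.QueryFree, h]

/-! ### Correctness of the search -/

lemma parse_data (P w : Str) (p : Str × Str) :
    parse (P.flatMap (fun b => [true, b]) ++ w) p = parse w (p.1, P.reverse ++ p.2) := by
  induction P generalizing p with
  | nil => simp
  | cons b P ih => simp [parse, ih]

lemma parse_input (u w : Str) (p : Str × Str) :
    parse (u.flatMap (fun b => [false, b]) ++ w) p = parse w (u.reverse ++ p.1, p.2) := by
  induction u generalizing p with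
  | nil => simp
  | cons b u ih => simp [parse, ih]

lemma decode_replicate_append (k : ℕ) (u : Str) :
    decode (List.replicate k false ++ true :: u) = u := by
  induction k with
  | zero => rfl
  | succ k ih => simpa [List.replicate_succ, decode] using ih

lemma parse_queryWord (u x P : Str) : parse (queryWord u x P) ([], []) =
    (List.replicate u.length false ++ true :: x, P.reverse) := by
  have h : ∀ (u : Str) (p : Str × Str), parse (u.flatMap fun _ => [false, false]) p =
      (List.replicate u.length false ++ p.1, p.2) := by
    intro u
    induction u with
    | nil => intro p; simp [parse]
    | cons b u ih => intro p; simp [parse, ih, List.replicate_succ']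
  rw [queryWord, parse_data, parse_input]
  simp [parse, h]

lemma instX_queryWord (u x P : Str) : instX (queryWord u x P) = x := by
  rw [instX, parse_queryWord, decode_replicate_append]

lemma instZ_queryWord (u x P : Str) : instZ (queryWord u x P) = P.reverse := by
  rw [instZ, parse_queryWord]

lemma numSamples_two_mul (k : ℕ) : numSamples (2 * k) = 8 * 4 ^ k := by
  rw [numSamples]
  congr 2
  omega

/-- If the number `m` of repetitions is at least `8 / q`, an event of probability `q` fails to
happen in all of them with probability at most `1 / 9`. -/
lemma pow_one_sub_le {q : ℝ} (h1 : q ≤ 1) {m : ℕ} (hm : 8 ≤ m * q) :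
    (1 - q) ^ m ≤ 1 / 9 := by
  have hq : 0 ≤ q := by
    by_contra h
    have : (m : ℝ) * q ≤ 0 := mul_nonpos_of_nonneg_of_nonpos (Nat.cast_nonneg _) (by linarith)
    linarith
  have hb : 1 + (m : ℝ) * q ≤ (1 + q) ^ m := one_add_mul_le_pow (by linarith) m
  have hp : 0 ≤ (1 - q) ^ m := pow_nonneg (by linarith) m
  have h : (1 - q) ^ m * (1 + q) ^ m ≤ 1 := by
    rw [← mul_pow]
    exact pow_le_one₀ (mul_nonneg (by linarith) (by linarith)) (by nlinarith)
  have := mul_le_mul_of_nonneg_left hb hp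
  nlinarith

/-- A correct answer about a prefix that is likely enough to be seen leads to a prefix with at least
a quarter of its probability. -/
lemma hitProb_answer {A : Prog} {p : Polynomial ℕ} {O : Str → Bool}
    (hO : (acceptance (samplerAcc A p)).Solves O) {u x P : Str} {c m : ℕ}
    (hc : u.length + 1 + P.length = c) (hm : m = 8 * 4 ^ (c + x.length))
    (h8 : 8 ≤ m * hitProb A x m (p.eval (x.length + m)) P.reverse) :
    hitProb A x m (p.eval (x.length + m)) P.reverse / 4 ≤
      hitProb A x m (p.eval (x.length + m)) (O (queryWord u x P) :: P).reverse := by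
  set w := queryWord u x P with hw
  have hN : numSamples w.length = m := by
    rw [hw, length_queryWord, hc, numSamples_two_mul, hm]
  have hacc : samplerAcc A p w =
      hitProb A x m (p.eval (x.length + m)) (P.reverse ++ [true]) *
        ∑ i ∈ Finset.range m, (1 - hitProb A x m (p.eval (x.length + m)) P.reverse) ^ i := by
    rw [samplerAcc, hN, hw, instX_queryWord, instZ_queryWord]
  rw [List.reverse_cons]
  have hsplit := hitProb_split A x m (p.eval (x.length + m)) P.reverse
  have hle := hitProb_le_one A x m (p.eval (x.length + m)) P.reverse
  have h0 := hitProb_nonneg A x m (p.eval (x.length + m)) (P.reverse ++ [false])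
  have h1 := hitProb_nonneg A x m (p.eval (x.length + m)) (P.reverse ++ [true])
  have hpow := pow_one_sub_le hle h8
  set q := hitProb A x m (p.eval (x.length + m)) P.reverse
  have hpow0 : 0 ≤ (1 - q) ^ m := pow_nonneg (by linarith) _
  have hgeom : q * ∑ i ∈ Finset.range m, (1 - q) ^ i = 1 - (1 - q) ^ m := by
    have := mul_neg_geom_sum (1 - q) m
    rwa [sub_sub_cancel] at this
  have hS : 0 ≤ ∑ i ∈ Finset.range m, (1 - q) ^ i :=
    Finset.sum_nonneg fun i _ => pow_nonneg (by linarith) _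
  set S := ∑ i ∈ Finset.range m, (1 - q) ^ i
  cases hOw : O w with
  | true =>
    by_contra! hlt
    have hno : w ∈ (acceptance (samplerAcc A p)).no := by
      change samplerAcc A p w ≤ 1 / 3
      rw [hacc]
      have := mul_le_mul_of_nonneg_right hlt.le hS
      linarith
    have := hO.2 w hno
    rw [hOw] at this
    exact Bool.noConfusion this
  | false =>
    by_contra! hlt
    have hyes : w ∈ (acceptance (samplerAcc A p)).yes := by
      change 2 / 3 ≤ samplerAcc A p w
      rw [hacc]
      have h34 : 3 / 4 * q ≤ hitProb A x m (p.eval (x.length + m)) (P.reverse ++ [true]) := by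
        linarith
      have := mul_le_mul_of_nonneg_right h34 hS
      linarith
    have := hO.1 w hyes
    rw [hOw] at this
    exact Bool.noConfusion this

/-- Each of the remaining rounds of the search costs at most a factor `4` in the probability of the
prefix. -/
lemma hitProb_search {A : Prog} {p : Polynomial ℕ} {O : Str → Bool}
    (hO : (acceptance (samplerAcc A p)).Solves O) {x : Str} {c m : ℕ}
    (hm : m = 8 * 4 ^ (c + x.length)) (u P : Str) (hc : u.length + P.length = c)
    (hP : 1 ≤ 4 ^ P.length * hitProb A x m (p.eval (x.length + m)) P.reverse) :
    1 ≤ 4 ^ c * hitProb A x m (p.eval (x.length + m)) (search O x u P).reverse := by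
  induction u generalizing P with
  | nil =>
    simp only [List.length_nil, zero_add] at hc
    subst hc
    exact hP
  | cons b u ih =>
    simp only [List.length_cons] at hc
    refine ih (O (queryWord u x P) :: P) (by simp only [List.length_cons]; omega) ?_
    have h0 := hitProb_nonneg A x m (p.eval (x.length + m)) P.reverse
    have h8 : 8 ≤ m * hitProb A x m (p.eval (x.length + m)) P.reverse := by
      have h4 : (4 : ℝ) ^ P.length ≤ 4 ^ (c + x.length) :=
        pow_le_pow_right₀ (by norm_num) (by omega)
      have := mul_le_mul_of_nonneg_right h4 h0
      have hm' : (m : ℝ) = 8 * 4 ^ (c + x.length) := by rw [hm]; push_cast; rfl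
      rw [hm', mul_assoc]
      linarith
    have h := hitProb_answer hO (u := u) (by omega) hm h8
    have h4 : (0 : ℝ) < 4 ^ P.length := by positivity
    have := mul_le_mul_of_nonneg_left h h4.le
    rw [List.length_cons, pow_succ]
    linarith

lemma eq_of_hit {z r : Str} (h : hit z r = true) (hl : r.length ≤ z.length) :
    z = r ++ List.replicate (z.length - r.length) false := by
  induction z generalizing r with
  | nil =>
    obtain rfl : r = [] := List.length_eq_zero_iff.1 (by simpa using hl)
    rfl
  | cons b z ih =>
    simp only [hit, Bool.and_eq_true, beq_iff_eq] at h
    obtain ⟨hb, hz⟩ := h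
    cases r with
    | nil =>
      have := ih hz (by simp)
      simp only [List.tail_nil, List.nil_append, List.length_nil, Nat.sub_zero,
        List.headD_nil] at this hb
      rw [hb, List.length_cons, List.nil_append, List.length_nil, Nat.sub_zero,
        List.replicate_succ, ← this]
    | cons a r =>
      have := ih hz (by simpa using hl)
      simp only [List.tail_cons, List.headD_cons] at this hb
      simp only [List.length_cons, Nat.add_sub_add_right, List.cons_append]
      rw [← this, hb]

/-- A long enough prefix of the stream of `y` determines `y`. -/
lemma decode_of_hit {P y : Str} (h : hit P.reverse (stream y) = true)
    (hl : y.length + 1 ≤ P.length) : decode P = y := by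
  obtain ⟨k, hk⟩ : ∃ k, P.reverse = stream y ++ List.replicate k false :=
    ⟨_, eq_of_hit h (by simpa [stream] using hl)⟩
  have : P = List.replicate k false ++ true :: y := by
    apply List.reverse_injective
    rw [hk]
    simp [stream]
  rw [this, decode_replicate_append]

/-- The search finds a solution. -/
lemma decode_search_mem {R : Relation} {A : Prog} {p b : Polynomial ℕ}
    (hb : ∀ x y : Str, (x, y) ∈ R → y.length ≤ b.eval x.length)
    {x : Str} (hx : Solvable R x)
    (hR : ∀ x : Str, Solvable R x → ∀ ε : ℝ, 0 < ε →
      1 - ε ≤ prob A (input x (List.replicate ⌈1 / ε⌉₊ false)) (p.eval (x.length + ⌈1 / ε⌉₊))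
        {y | (x, y) ∈ R})
    {O : Str → Bool} (hO : (acceptance (samplerAcc A p)).Solves O) {c : ℕ}
    (hc : b.eval x.length + 1 ≤ c) :
    (x, decode (search O x (List.replicate c false) [])) ∈ R := by
  classical
  obtain ⟨m, hm⟩ : ∃ m, m = 8 * 4 ^ (c + x.length) := ⟨_, rfl⟩
  have hm' : (m : ℝ) = 8 * 4 ^ (c + x.length) := by rw [hm]; push_cast; rfl
  have hm0 : (0 : ℝ) < m := by rw [hm']; positivity
  have h := hitProb_search hO hm (List.replicate c false) [] (by simp) (by simp [hitProb_nil])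
  set P := search O x (List.replicate c false) [] with hP
  have hPl : P.length = c := by rw [hP, length_search]; simp
  have hprob := hR x hx (1 / m) (by positivity)
  rw [one_div_one_div, Nat.ceil_natCast, prob_eq_ev] at hprob
  -- The prefix that was found has probability greater than the error `1 / m`.
  have hlarge : 1 / (m : ℝ) < hitProb A x m (p.eval (x.length + m)) P.reverse := by
    rw [div_lt_iff₀ hm0, hm']
    have h4 : (4 : ℝ) ^ c ≤ 4 ^ (c + x.length) := pow_le_pow_right₀ (by norm_num) (by omega)
    have := mul_le_mul_of_nonneg_right h4
      (hitProb_nonneg A x m (p.eval (x.length + m)) P.reverse)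
    linarith
  obtain ⟨s, hs, hsR⟩ : ∃ s : Store, hit P.reverse (stream (s 0)) = true ∧ (x, s 0) ∈ R := by
    by_contra! hne
    have haff := ev_affine noOracle (fun s => if s 0 ∈ {y | (x, y) ∈ R} then 1 else 0)
      (fun s => if hit P.reverse (stream (s 0)) then 1 else 0) 0 1 1 (p.eval (x.length + m))
      ([A], input x (List.replicate m false))
    have hle := ev_mono noOracle
      (f := fun s => 0 + 1 * (if s 0 ∈ {y | (x, y) ∈ R} then 1 else 0) +
        1 * (if hit P.reverse (stream (s 0)) then 1 else 0)) (g := fun _ => 1)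
      (fun s => by
        have := hne s
        by_cases h1 : hit P.reverse (stream (s 0)) = true
        · simp [h1, this h1]
        · by_cases h2 : (x, s 0) ∈ R <;> simp [h1, h2])
      (p.eval (x.length + m)) ([A], input x (List.replicate m false))
    rw [haff, ev_const] at hle
    rw [hitProb] at hlarge
    linarith
  rw [decode_of_hit hs (by have := hb x _ hsR; omega)]
  exact hsR

/-! ### Polynomial time -/

/-- A bound that the searcher can compute in unary. -/
lemma exists_le_mul_pow (b : Polynomial ℕ) :
    ∃ a d : ℕ, ∀ n : ℕ, b.eval n + 1 ≤ a * (n + 1) ^ d := by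
  induction b using Polynomial.induction_on' with
  | add p q hp hq =>
    obtain ⟨a, d, h⟩ := hp
    obtain ⟨a', d', h'⟩ := hq
    refine ⟨a + a', d + d', fun n => ?_⟩
    have h1 : a * (n + 1) ^ d ≤ a * (n + 1) ^ (d + d') :=
      Nat.mul_le_mul_left _ (Nat.pow_le_pow_right (by omega) (by omega))
    have h2 : a' * (n + 1) ^ d' ≤ a' * (n + 1) ^ (d + d') :=
      Nat.mul_le_mul_left _ (Nat.pow_le_pow_right (by omega) (by omega))
    have := h n
    have := h' n
    rw [Polynomial.eval_add, add_mul]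
    omega
  | monomial k a =>
    refine ⟨a + 1, k, fun n => ?_⟩
    have h1 : a * n ^ k ≤ a * (n + 1) ^ k :=
      Nat.mul_le_mul_left _ (Nat.pow_le_pow_left (by omega) _)
    have h2 : 1 ≤ (n + 1) ^ k := Nat.one_le_pow _ _ (by omega)
    rw [Polynomial.eval_monomial, add_mul]
    omega

open Polynomial in
/-- The running time of the searcher is polynomial if the time for a query is. -/
lemma exists_searchTime_eq (a d : ℕ) (t : Polynomial ℕ) :
    ∃ P : Polynomial ℕ, ∀ N, searchTime a d (t.eval N) N = P.eval N := by
  refine ⟨C d * ((16 * X + 17) * (C a * (X + 1) ^ d) + 4) +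
    (22 * (C a * (X + 1) ^ d) + 22 * X + t + 24) * (C a * (X + 1) ^ d) +
    18 * (C a * (X + 1) ^ d) + 21 * X + 2 * C a + 40, fun N => ?_⟩
  simp [searchTime]

/-- The output of the searcher. -/
lemma Exec.runDet_searchProg {O' O : Str → Bool} {K a d : ℕ} (hK : 2 ≤ K) {ask : Prog}
    {V x : Str} {τ N : ℕ} (hask : Answers O' K ask V O (2 * (a * (x.length + 1) ^ d + x.length)) τ)
    (hx : x.length ≤ N) (hV : V.length ≤ N) :
    HaltsDet O' (searchProg K a d ask) (input x V) (searchTime a d τ N) ∧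
      outDet O' (searchProg K a d ask) (input x V) (searchTime a d τ N) =
        decode (search O x (List.replicate (a * (x.length + 1) ^ d) false) []) := by
  have h := (exec_searchProg hK hask hx hV).runDet
  rw [HaltsDet, outDet, h]
  exact ⟨rfl, by simp [Cfg.output, mk_lo (show 0 < K by omega)]⟩

/-- The searcher with the acceptance problem of the sampler as its oracle. -/
theorem FBPP_subset_FPOracle : FBPP ⊆ FPOracle PromiseBPEXP := by
  rintro R ⟨⟨b, hb⟩, A, p, hA, hp, hR⟩
  obtain ⟨a, d, had⟩ := exists_le_mul_pow b
  obtain ⟨P, hP⟩ := exists_searchTime_eq a d 1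
  have key := fun (O : Str → Bool) (x : Str) =>
    Exec.runDet_searchProg (a := a) (d := d) (x := x) le_rfl (answers_query O 2 [] _) le_rfl
      (Nat.zero_le _)
  simp only [Polynomial.eval_one] at hP
  simp only [hP] at key
  refine ⟨⟨b, hb⟩, acceptance (samplerAcc A p), acceptance_mem_promiseBPEXP hA hp,
    searchProg 2 a d (.query (2 + 3) (2 + 2)), P, tossFree_searchProg _ _ _ trivial,
    fun O x => (key O x).1, fun O hO x hx => ?_⟩
  rw [(key O x).2]
  exact decode_search_mem hb hx hR hO (had _)

open Polynomial in
/-- The searcher with a program for the acceptance problem, run with its advice, in place of the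
oracle. -/
theorem FBPP_subset_FPPoly (h : PromiseBPEXP ⊆ PromisePPoly) : FBPP ⊆ FPPoly := by
  rintro R ⟨⟨b, hb⟩, A, p, hA, hp, hR⟩
  obtain ⟨a, d, had⟩ := exists_le_mul_pow b
  obtain ⟨B, pB, qB, adv, hBt, hBq, hBp, hadv, hyes, hno⟩ :=
    h (acceptance_mem_promiseBPEXP hA hp)
  obtain ⟨K, hK, hBK⟩ := B.exists_below
  -- All queries for inputs of length `n` have length `ℓ n`, so one advice string of `B` is enough.
  set ℓ : Polynomial ℕ := 2 * (C a * (X + 1) ^ d + X) with hℓ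
  have hℓe : ∀ n, ℓ.eval n = 2 * (a * (n + 1) ^ d + n) := fun n => by simp [hℓ]
  set t : Polynomial ℕ := 16 * ℓ + 16 * X + pB.comp (ℓ + X) +
    C K * (2 * (ℓ + X + pB.comp (ℓ + X)) + 2) + 16 with ht
  have hte : ∀ n, t.eval n = 16 * ℓ.eval n + 16 * n + pB.eval (ℓ.eval n + n) +
      K * (2 * (ℓ.eval n + n + pB.eval (ℓ.eval n + n)) + 2) + 16 := fun n => by simp [ht]
  obtain ⟨P, hP⟩ := exists_searchTime_eq a d t
  have hans : ∀ (x V : Str), Answers noOracle K (askProg K B) V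
      (fun W => outDet noOracle B (input W V) (pB.eval (W.length + V.length)) == [true])
      (2 * (a * (x.length + 1) ^ d + x.length)) (t.eval (x.length + V.length)) := by
    intro x V Y D Q W hW
    refine (answers_askProg noOracle hK hBK hBt hBq hBp V _ Y D Q W hW).mono ?_
    rw [← hℓe, hte]
    have h1 : ℓ.eval x.length ≤ ℓ.eval (x.length + V.length) := eval_mono _ (by omega)
    have h2 : pB.eval (ℓ.eval x.length + V.length) ≤
        pB.eval (ℓ.eval (x.length + V.length) + (x.length + V.length)) := eval_mono _ (by omega)
    gcongr <;> omega
  refine ⟨⟨b, hb⟩, searchProg K a d (askProg K B), P, qB.comp ℓ,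
    fun n => adv (2 * (a * (n + 1) ^ d + n)), tossFree_searchProg _ _ _ (tossFree_askProg _ hBt),
    queryFree_searchProg _ _ _ (queryFree_askProg _ hBq), fun x V => ?_, fun n => ?_,
    fun x hx => ?_⟩
  · rw [← hP]
    exact (Exec.runDet_searchProg hK (hans x V) (by omega) (by omega)).1
  · rw [eval_comp, hℓe]
    exact hadv _
  · have hans' : Answers noOracle K (askProg K B) (adv (2 * (a * (x.length + 1) ^ d + x.length)))
        (fun W => outDet noOracle B (input W (adv W.length))
          (pB.eval (W.length + (adv W.length).length)) == [true])
        (2 * (a * (x.length + 1) ^ d + x.length))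
        (t.eval (x.length + (adv (2 * (a * (x.length + 1) ^ d + x.length))).length)) := by
      intro Y D Q W hW
      have := hans x (adv (2 * (a * (x.length + 1) ^ d + x.length))) Y D Q W hW
      rw [← hW] at this ⊢
      exact this
    rw [← hP, (Exec.runDet_searchProg hK hans' (Nat.le_add_right _ _) (Nat.le_add_left _ _)).2]
    refine decode_search_mem hb hx hR ⟨fun w hw => ?_, fun w hw => ?_⟩ (had _)
    · simpa using hyes w hw
    · simpa using hno w hw

end RelComplexity

theorem mainTheorem3 :
    RelComplexity.FBPP ⊆ RelComplexity.FPOracle RelComplexity.PromiseBPEXP ∧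
      (RelComplexity.PromiseBPEXP ⊆ RelComplexity.PromisePPoly →
        RelComplexity.FBPP ⊆ RelComplexity.FPPoly) :=
  ⟨RelComplexity.FBPP_subset_FPOracle, RelComplexity.FBPP_subset_FPPoly⟩
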